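/- Let $k\ge 0$ be an integer. Let $M=M(\mathcal T^kS^4)$ be the Sullivan minimal model over $\mathbb R$ of the $k$-toroidification $\mathcal T^kS^4=\mathrm{Map}^0(T^k,S^4)/\!\!/T^k$, i.e. the following explicit differential graded commutative algebra. Let $U=\mathbb R[s_1,\dots,s_k]\otimes(\mathbb R g_4\oplus\mathbb R g_7)$, where $s_1,\dots,s_k$ are anticommuting variables of degree $-1$ and $|g_4|=4$, $|g_7|=7$; let $U^{>0}$ be its positive-degree part (elements of non-positive degree are set to $0$). As a graded algebra, $M$ is the free graded commutative unital algebra $S(U^{>0})\otimes\mathbb R[w_1,\dots,w_k]$ with $|w_i|=2$; so its generators are $s_Ig_4$ ($|I|\le 3$), $s_Ig_7$ ($|I|\le 6$) and $w_1,\dots,w_k$, where $I\subseteq\{1,\dots,k\}$ and $s_I=s_{i_1}\cdots s_{i_p}$ for $I=\{i_1<\dots<i_p\}$. Multiplication by $s_i$ is extended to $M$ as a derivation of degree $-1$ with $s_iw_j=0$, and the differential $d$ is the derivation of degree $+1$ determined by $$dg_4=\sum_{i=1}^k w_i\cdot s_ig_4,\qquad dg_7=-\tfrac12 g_4^2+\sum_{i=1}^k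 w_i\cdot s_ig_7,\qquad dw_i=0,\qquad ds_i+s_id=0 .$$ Let $\mathrm{Aut}\,M$ be the group of degree-preserving algebra automorphisms of $M$ commuting with $d$. With the regular functions generated by the matrix coefficients $\varphi\mapsto\ell(\varphi(x))$ and $\varphi\mapsto\ell(\varphi^{-1}(x))$ ($x\in M$, $\ell$ a linear functional on $M$), $\mathrm{Aut}\,M$ is (the group of real points of) a real affine algebraic group. Moreover: 1. There is a unique group homomorphism $\theta:\mathbb G_m(\mathbb R)\times T^k_{\mathbb C}(\mathbb R)=\mathbb R^\times\times(\mathbb R^\times)^k\to\mathrm{Aut}\,M$ such that $t=(t_0,t_1,\dots,t_k)$ acts on the generators by $$t\cdot s_Ig_4=t_0\prod_{i\in I}t_i^{-1}\;s_Ig_4,\qquad t\cdot s_Ig_7=t_0^2\prod_{i\in I}t_i^{-1}\;s_Ig_7,\qquad t\cdot w_i=t_i\,w_i,$$ and on all of $M$ one has $t\,s_i\,t^{-1}=t_i^{-1}s_i$. (Here $T^k_{\mathbb C}(\mathbb R)\cong(\mathbb R^\times)^k$ denotes the split form of the complexification of $T^k=(S^1)^k$.) 2. The homomorphism $\theta$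 is injective and is a closed embedding of real algebraic groups: the pullbacks along $\theta$ of the regular functions on $\mathrm{Aut}\,M$ are exactly the Laurent polynomials in $t_0,\dots,t_k$. Thus its image $T$ is an $\mathbb R$-split torus in $\mathrm{Aut}\,M$ isomorphic to $\mathbb G_m(\mathbb R)\times T^k_{\mathbb C}(\mathbb R)\cong(\mathbb R^\times)^{k+1}$. 3. $T$ is a maximal $\mathbb R$-split torus in $\mathrm{Aut}\,M$: every $\mathbb R$-split torus of $\mathrm{Aut}\,M$ containing $T$ equals $T$. 4. Every element of $\mathrm{Aut}\,M$ that commutes with every element of $T$ belongs to $T$. -/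

import Mathlib

namespace Toroidification

section FreeGradedCommutative

/-- The graded commutativity relations `a b = (-1)^{|a||b|} b a` between generators. -/
inductive GCRel {ι : Type} (deg : ι → ℕ) : FreeAlgebra ℝ ι → FreeAlgebra ℝ ι → Prop
  | swap (a b : ι) : GCRel deg (FreeAlgebra.ι ℝ a * FreeAlgebra.ι ℝ b)
      (((-1 : ℝ) ^ (deg a * deg b)) • (FreeAlgebra.ι ℝ b * FreeAlgebra.ι ℝ a))

/-- The free graded commutative unital real algebra `S(V)` on the graded vector space `V` with
homogeneous basis `ι`, the generator `a` having degree `deg a`: the tensor algebra of `V` modulo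
graded commutativity (the square of an odd generator vanishes, since `2` is invertible). -/
def FreeGC {ι : Type} (deg : ι → ℕ) : Type := RingQuot (GCRel deg)

noncomputable instance {ι : Type} (deg : ι → ℕ) : Ring (FreeGC deg) :=
  inferInstanceAs (Ring (RingQuot (GCRel deg)))

noncomputable instance {ι : Type} (deg : ι → ℕ) : Algebra ℝ (FreeGC deg) :=
  inferInstanceAs (Algebra ℝ (RingQuot (GCRel deg)))

/-- The quotient map from the tensor algebra. -/
noncomputable def FreeGC.mk {ι : Type} (deg : ι → ℕ) : FreeAlgebra ℝ ι →ₐ[ℝ] FreeGC deg :=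
  RingQuot.mkAlgHom ℝ (GCRel deg)

variable {ι : Type} (deg : ι → ℕ)

/-- The generators. -/
noncomputable def gen (a : ι) : FreeGC deg :=
  FreeGC.mk deg (FreeAlgebra.ι ℝ a)

/-- The product of a list of generators. -/
noncomputable def word (l : List ι) : FreeGC deg := (l.map (gen deg)).prod

/-- The homogeneous component of degree `n`. -/
noncomputable def homog (n : ℕ) : Submodule ℝ (FreeGC deg) :=
  Submodule.span ℝ {x | ∃ l : List ι, (l.map deg).sum = n ∧ x = word deg l}

/-- The span of the homogeneous components whose degree has the parity of `n`. -/
noncomputable def parity (n : ℕ) : Submodule ℝ (FreeGC deg) :=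
  Submodule.span ℝ {x | ∃ l : List ι, (l.map deg).sum ≡ n [MOD 2] ∧ x = word deg l}

theorem gen_mul_gen (a b : ι) :
    gen deg a * gen deg b = ((-1 : ℝ) ^ (deg a * deg b)) • (gen deg b * gen deg a) := by
  have h : FreeGC.mk deg _ = FreeGC.mk deg _ :=
    RingQuot.mkAlgHom_rel ℝ (GCRel.swap (deg := deg) a b)
  simpa [gen] using h

theorem FreeGC.induct {p : FreeGC deg → Prop} (hs : ∀ r : ℝ, p (algebraMap ℝ _ r))
    (hg : ∀ a, p (gen deg a)) (hm : ∀ x y, p x → p y → p (x * y))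
    (ha : ∀ x y, p x → p y → p (x + y)) (x : FreeGC deg) : p x := by
  obtain ⟨y, rfl⟩ : ∃ y, FreeGC.mk deg y = x := RingQuot.mkAlgHom_surjective ℝ (GCRel deg) x
  induction y using FreeAlgebra.induction with
  | grade0 r => simpa using hs r
  | grade1 a => exact hg a
  | mul x y hx hy => simpa using hm _ _ hx hy
  | add x y hx hy => simpa using ha _ _ hx hy

theorem neg_one_pow_eq {m n : ℕ} (h : m ≡ n [MOD 2]) : (-1 : ℝ) ^ m = (-1) ^ n := by
  rw [neg_one_pow_eq_pow_mod_two, neg_one_pow_eq_pow_mod_two (n := n)]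
  rw [h]

theorem homog_le_parity {m n : ℕ} (h : m ≡ n [MOD 2]) : homog deg m ≤ parity deg n := by
  apply Submodule.span_mono
  rintro x ⟨l, hl, rfl⟩
  exact ⟨l, hl ▸ h, rfl⟩

theorem word_mem_homog (l : List ι) : word deg l ∈ homog deg (l.map deg).sum :=
  Submodule.subset_span ⟨l, rfl, rfl⟩

theorem gen_mem_homog (a : ι) : gen deg a ∈ homog deg (deg a) := by
  simpa [word] using word_mem_homog deg [a]

theorem word_append (l m : List ι) : word deg (l ++ m) = word deg l * word deg m := by
  simp [word]

theorem homog_mul {m n : ℕ} {x y : FreeGC deg} (hx : x ∈ homog deg m) (hy : y ∈ homog deg n) :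
    x * y ∈ homog deg (m + n) := by
  have h := Submodule.mul_mem_mul hx hy
  rw [homog, homog, Submodule.span_mul_span] at h
  refine Submodule.span_mono ?_ h
  rintro _ ⟨_, ⟨l, hl, rfl⟩, _, ⟨m, hm, rfl⟩, rfl⟩
  exact ⟨l ++ m, by simp [hl, hm], (word_append deg l m).symm⟩

theorem parity_mul {m n : ℕ} {x y : FreeGC deg} (hx : x ∈ parity deg m) (hy : y ∈ parity deg n) :
    x * y ∈ parity deg (m + n) := by
  have h := Submodule.mul_mem_mul hx hy
  rw [parity, parity, Submodule.span_mul_span] at h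
  refine Submodule.span_mono ?_ h
  rintro _ ⟨_, ⟨l, hl, rfl⟩, _, ⟨m, hm, rfl⟩, rfl⟩
  exact ⟨l ++ m, by simpa using hl.add hm, (word_append deg l m).symm⟩

theorem word_mul_gen (l : List ι) (b : ι) : word deg l * gen deg b =
    ((-1 : ℝ) ^ ((l.map deg).sum * deg b)) • (gen deg b * word deg l) := by
  induction l with
  | nil => simp [word]
  | cons a l ih =>
    have e : word deg (a :: l) = gen deg a * word deg l := by simp [word]
    rw [e, mul_assoc, ih, mul_smul_comm, ← mul_assoc, gen_mul_gen, smul_mul_assoc, smul_smul,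
      mul_assoc]
    congr 1
    rw [List.map_cons, List.sum_cons, add_mul, pow_add, mul_comm]

theorem parity_mul_gen {n : ℕ} {x : FreeGC deg} (hx : x ∈ parity deg n) (b : ι) :
    x * gen deg b = ((-1 : ℝ) ^ (n * deg b)) • (gen deg b * x) := by
  induction hx using Submodule.span_induction with
  | mem x h =>
    obtain ⟨l, hl, rfl⟩ := h
    rw [word_mul_gen, neg_one_pow_eq (hl.mul_right _)]
  | zero => simp
  | add x y _ _ hx hy => rw [add_mul, hx, hy, mul_add, smul_add]
  | smul r x _ hx => rw [smul_mul_assoc, hx, mul_smul_comm, smul_comm]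

/-- Universal property of `S(V)`. -/
noncomputable def lift {B : Type} [Ring B] [Algebra ℝ B] (f : ι → B)
    (hf : ∀ a b, f a * f b = ((-1 : ℝ) ^ (deg a * deg b)) • (f b * f a)) : FreeGC deg →ₐ[ℝ] B :=
  RingQuot.liftAlgHom ℝ ⟨FreeAlgebra.lift ℝ f, by
    rintro _ _ ⟨a, b⟩
    simpa using hf a b⟩

theorem lift_gen {B : Type} [Ring B] [Algebra ℝ B] (f : ι → B)
    (hf : ∀ a b, f a * f b = ((-1 : ℝ) ^ (deg a * deg b)) • (f b * f a)) (a : ι) :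
    lift deg f hf (gen deg a) = f a := by
  have h := RingQuot.liftAlgHom_mkAlgHom_apply ℝ (FreeAlgebra.lift ℝ f) (s := GCRel deg) (by
    rintro _ _ ⟨a, b⟩
    simpa using hf a b) (FreeAlgebra.ι ℝ a)
  rw [FreeAlgebra.lift_ι_apply] at h
  exact h

/-- The sign automorphism `x ↦ (-1)^{|x|} x`. -/
noncomputable def signAut : FreeGC deg →ₐ[ℝ] FreeGC deg :=
  lift deg (fun a => ((-1 : ℝ) ^ deg a) • gen deg a) (by
    intro a b
    rw [smul_mul_smul_comm, smul_mul_smul_comm, gen_mul_gen deg a b, smul_comm,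
      mul_comm ((-1 : ℝ) ^ deg a)])

theorem signAut_gen (a : ι) : signAut deg (gen deg a) = ((-1 : ℝ) ^ deg a) • gen deg a :=
  lift_gen _ _ _ _

/-- Auxiliary to `oddDeriv`: `x ↦ !![(-1)^{|x|} x, D x; 0, x]` is an algebra homomorphism exactly
when `D (x y) = D x * y + (-1)^{|x|} x * D y`. -/
noncomputable def derivHom (f : ι → FreeGC deg) (hf : ∀ a, f a ∈ parity deg (deg a + 1)) :
    FreeGC deg →ₐ[ℝ] Matrix (Fin 2) (Fin 2) (FreeGC deg) :=
  lift deg (fun a => !![signAut deg (gen deg a), f a; 0, gen deg a]) (by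
    have key : ∀ a b, f a * gen deg b =
        ((-1 : ℝ) ^ (deg a * deg b)) • (signAut deg (gen deg b) * f a) := by
      intro a b
      rw [parity_mul_gen deg (hf a), signAut_gen, smul_mul_assoc, smul_smul, add_mul, one_mul,
        pow_add]
    intro a b
    ext i j
    fin_cases i <;> fin_cases j <;> simp [Matrix.mul_apply, Fin.sum_univ_two]
    · rw [← map_mul, gen_mul_gen, map_smul, map_mul]
    · rw [key a b, key b a, smul_smul, mul_comm (deg b), ← mul_pow]
      simp [add_comm]
    · exact gen_mul_gen deg a b)

/-- The odd derivation of `S(V)` with prescribed values on the generators, that is, the linear map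
with `D a = f a` on generators and `D (x y) = D x * y + (-1)^{|x|} x * D y`
(`oddDeriv_gen`, `oddDeriv_mul`). -/
noncomputable def oddDeriv (f : ι → FreeGC deg) (hf : ∀ a, f a ∈ parity deg (deg a + 1)) :
    FreeGC deg →ₗ[ℝ] FreeGC deg where
  toFun x := derivHom deg f hf x 0 1
  map_add' x y := by simp
  map_smul' r x := by simp

theorem oddDeriv_gen (f : ι → FreeGC deg) (hf : ∀ a, f a ∈ parity deg (deg a + 1)) (a : ι) :
    oddDeriv deg f hf (gen deg a) = f a := by
  simp [oddDeriv, derivHom, lift_gen]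

theorem derivHom_entries (f : ι → FreeGC deg) (hf : ∀ a, f a ∈ parity deg (deg a + 1))
    (x : FreeGC deg) : derivHom deg f hf x 0 0 = signAut deg x ∧ derivHom deg f hf x 1 0 = 0 ∧
      derivHom deg f hf x 1 1 = x := by
  induction x using FreeGC.induct with
  | hs r => simp [Matrix.algebraMap_matrix_apply]
  | hg a => simp [derivHom, lift_gen]
  | hm x y hx hy =>
    simp [Matrix.mul_apply, Fin.sum_univ_two, hx, hy]
  | ha x y hx hy => simp [hx, hy]

theorem oddDeriv_mul (f : ι → FreeGC deg) (hf : ∀ a, f a ∈ parity deg (deg a + 1))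
    (x y : FreeGC deg) : oddDeriv deg f hf (x * y) =
      oddDeriv deg f hf x * y + signAut deg x * oddDeriv deg f hf y := by
  have hx := derivHom_entries deg f hf x
  have hy := derivHom_entries deg f hf y
  simp [oddDeriv, Matrix.mul_apply, Fin.sum_univ_two, hx.1, hy.2.2, add_comm]

theorem oddDeriv_algebraMap (f : ι → FreeGC deg) (hf : ∀ a, f a ∈ parity deg (deg a + 1))
    (r : ℝ) : oddDeriv deg f hf (algebraMap ℝ _ r) = 0 := by
  simp [oddDeriv, Matrix.algebraMap_matrix_apply]

theorem signAut_of_mem {n : ℕ} {x : FreeGC deg} (hx : x ∈ parity deg n) :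
    signAut deg x = ((-1 : ℝ) ^ n) • x := by
  induction hx using Submodule.span_induction with
  | mem x h =>
    obtain ⟨l, hl, rfl⟩ := h
    rw [← neg_one_pow_eq hl]
    clear hl
    induction l with
    | nil => simp [word]
    | cons a l ih =>
      have e : word deg (a :: l) = gen deg a * word deg l := by simp [word]
      rw [e, map_mul, ih, signAut_gen, smul_mul_smul_comm]
      simp [pow_add]
  | zero => simp
  | add x y _ _ hx hy => rw [map_add, hx, hy, smul_add]
  | smul r x _ hx => rw [map_smul, hx, smul_comm]

theorem oddDeriv_mem_parity (f : ι → FreeGC deg) (hf : ∀ a, f a ∈ parity deg (deg a + 1))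
    {n : ℕ} {x : FreeGC deg} (hx : x ∈ parity deg n) :
    oddDeriv deg f hf x ∈ parity deg (n + 1) := by
  induction hx using Submodule.span_induction with
  | mem x h =>
    obtain ⟨l, hl, rfl⟩ := h
    have hp : ∀ {m n : ℕ}, m ≡ n [MOD 2] → parity deg m ≤ parity deg n := by
      intro m n h
      apply Submodule.span_mono
      rintro x ⟨l, hl, rfl⟩
      exact ⟨l, hl.trans h, rfl⟩
    refine hp (hl.add_right 1) ?_
    clear hl
    induction l with
    | nil =>
      have : oddDeriv deg f hf (word deg []) = 0 := by
        simpa [word] using oddDeriv_algebraMap deg f hf 1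
      rw [this]; exact zero_mem _
    | cons a l ih =>
      have e : word deg (a :: l) = gen deg a * word deg l := by simp [word]
      rw [e, oddDeriv_mul, oddDeriv_gen, signAut_gen, List.map_cons, List.sum_cons]
      refine add_mem ?_ ?_
      · have := parity_mul deg (hf a) (homog_le_parity deg rfl (word_mem_homog deg l))
        convert this using 2; ring
      · rw [smul_mul_assoc]
        refine Submodule.smul_mem _ _ ?_
        have := parity_mul deg (homog_le_parity deg rfl (gen_mem_homog deg a)) ih
        convert this using 2; ring
  | zero => simp
  | add x y _ _ hx hy => rw [map_add]; exact add_mem hx hy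
  | smul r x _ hx => rw [map_smul]; exact Submodule.smul_mem _ _ hx

theorem oddDeriv_up (f : ι → FreeGC deg) (hf : ∀ a, f a ∈ parity deg (deg a + 1))
    (hd : ∀ a, f a ∈ homog deg (deg a + 1)) {n : ℕ} {x : FreeGC deg} (hx : x ∈ homog deg n) :
    oddDeriv deg f hf x ∈ homog deg (n + 1) := by
  induction hx using Submodule.span_induction with
  | mem x h =>
    obtain ⟨l, rfl, rfl⟩ := h
    induction l with
    | nil =>
      have : oddDeriv deg f hf (word deg []) = 0 := by
        simpa [word] using oddDeriv_algebraMap deg f hf 1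
      rw [this]; exact zero_mem _
    | cons a l ih =>
      have e : word deg (a :: l) = gen deg a * word deg l := by simp [word]
      rw [e, oddDeriv_mul, oddDeriv_gen, signAut_gen, List.map_cons, List.sum_cons]
      refine add_mem ?_ ?_
      · have := homog_mul deg (hd a) (word_mem_homog deg l)
        convert this using 2; ring
      · rw [smul_mul_assoc]
        refine Submodule.smul_mem _ _ ?_
        have := homog_mul deg (gen_mem_homog deg a) ih
        convert this using 2; ring
  | zero => simp
  | add x y _ _ hx hy => rw [map_add]; exact add_mem hx hy
  | smul r x _ hx => rw [map_smul]; exact Submodule.smul_mem _ _ hx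

theorem oddDeriv_down (hpos : ∀ a, 0 < deg a) (f : ι → FreeGC deg)
    (hf : ∀ a, f a ∈ parity deg (deg a + 1)) (hd : ∀ a, f a ∈ homog deg (deg a - 1))
    {n : ℕ} {x : FreeGC deg} (hx : x ∈ homog deg n) :
    oddDeriv deg f hf x ∈ homog deg (n - 1) := by
  induction hx using Submodule.span_induction with
  | mem x h =>
    obtain ⟨l, rfl, rfl⟩ := h
    have h1 : oddDeriv deg f hf (word deg []) = 0 := by
      simpa [word] using oddDeriv_algebraMap deg f hf 1
    induction l with
    | nil => rw [h1]; exact zero_mem _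
    | cons a l ih =>
      have e : word deg (a :: l) = gen deg a * word deg l := by simp [word]
      have ha := hpos a
      rw [e, oddDeriv_mul, oddDeriv_gen, signAut_gen, List.map_cons, List.sum_cons]
      refine add_mem ?_ ?_
      · have := homog_mul deg (hd a) (word_mem_homog deg l)
        convert this using 2; omega
      · rw [smul_mul_assoc]
        refine Submodule.smul_mem _ _ ?_
        cases l with
        | nil => rw [h1, mul_zero]; exact zero_mem _
        | cons b l =>
          have := homog_mul deg (gen_mem_homog deg a) ih
          have hb := hpos b
          convert this using 2
          simp only [List.map_cons, List.sum_cons]; omega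
  | zero => simp
  | add x y _ _ hx hy => rw [map_add]; exact add_mem hx hy
  | smul r x _ hx => rw [map_smul]; exact Submodule.smul_mem _ _ hx

theorem signAut_signAut (x : FreeGC deg) : signAut deg (signAut deg x) = x := by
  induction x using FreeGC.induct with
  | hs r => simp
  | hg a =>
    rw [signAut_gen, map_smul, signAut_gen, smul_smul, ← mul_pow]
    simp
  | hm x y hx hy => simp [hx, hy]
  | ha x y hx hy => simp [hx, hy]

theorem oddDeriv_signAut (f : ι → FreeGC deg) (hf : ∀ a, f a ∈ parity deg (deg a + 1))
    (x : FreeGC deg) :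
    oddDeriv deg f hf (signAut deg x) = -signAut deg (oddDeriv deg f hf x) := by
  induction x using FreeGC.induct with
  | hs r => simp [oddDeriv_algebraMap]
  | hg a =>
    rw [signAut_gen, map_smul, oddDeriv_gen, signAut_of_mem deg (hf a), pow_succ]
    rw [mul_neg_one, neg_smul, neg_neg]
  | hm x y hx hy =>
    rw [map_mul, oddDeriv_mul, hx, hy, oddDeriv_mul, map_add, map_mul, map_mul]
    noncomm_ring
  | ha x y hx hy => rw [map_add, map_add, hx, hy, map_add, map_add]; abel

theorem anticommute (f g : ι → FreeGC deg) (hf : ∀ a, f a ∈ parity deg (deg a + 1))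
    (hg : ∀ a, g a ∈ parity deg (deg a + 1))
    (h : ∀ a, oddDeriv deg f hf (g a) = -oddDeriv deg g hg (f a)) (x : FreeGC deg) :
    oddDeriv deg f hf (oddDeriv deg g hg x) = -oddDeriv deg g hg (oddDeriv deg f hf x) := by
  induction x using FreeGC.induct with
  | hs r => simp [oddDeriv_algebraMap]
  | hg a => rw [oddDeriv_gen, oddDeriv_gen, h]
  | hm x y hx hy =>
    simp only [oddDeriv_mul, map_add, oddDeriv_signAut, signAut_signAut, hx, hy]
    noncomm_ring
  | ha x y hx hy => simp only [map_add, hx, hy]; abel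

end FreeGradedCommutative

section Model

/-- The generators of the model `M(T^k S⁴)`: `s_I g₄` and `s_I g₇`, where for
`I = {i₁ < ⋯ < i_p}` one writes `s_I = s_{i₁} ⋯ s_{i_p}`, restricted to positive degree, and
`w₁, …, w_k`. -/
inductive Generator (k : ℕ) : Type
  | sg4 (I : Finset (Fin k)) (h : I.card ≤ 3) : Generator k
  | sg7 (I : Finset (Fin k)) (h : I.card ≤ 6) : Generator k
  | w (i : Fin k) : Generator k

/-- `|s_I g₄| = 4 - |I|`, `|s_I g₇| = 7 - |I|`, `|w_i| = 2`. -/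
def Generator.deg {k : ℕ} : Generator k → ℕ
  | .sg4 I _ => 4 - I.card
  | .sg7 I _ => 7 - I.card
  | .w _ => 2

theorem Generator.deg_pos {k : ℕ} (a : Generator k) : 0 < a.deg := by
  cases a <;> simp only [Generator.deg] <;> omega

/-- The underlying graded algebra `S(U_k^{>0}) ⊗ ℝ[w₁, …, w_k]` of `M(T^k S⁴)`, where
`U_k = ℝ[s₁, …, s_k] ⊗ (ℝ g₄ ⊕ ℝ g₇)` and the `s_i` are anticommuting variables of degree `-1`. -/
abbrev Model (k : ℕ) : Type := FreeGC (Generator.deg (k := k))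

variable {k : ℕ}

/-- The generator `w_i`. -/
noncomputable def w (i : Fin k) : Model k := gen _ (Generator.w i)

/-- The element `s_I g₄`, which is zero when its degree is not positive. In particular `g₄` is
`sg4 ∅`. -/
noncomputable def sg4 (I : Finset (Fin k)) : Model k :=
  if h : I.card ≤ 3 then gen _ (Generator.sg4 I h) else 0

/-- The element `s_I g₇`, which is zero when its degree is not positive. In particular `g₇` is
`sg7 ∅`. -/
noncomputable def sg7 (I : Finset (Fin k)) : Model k :=
  if h : I.card ≤ 6 then gen _ (Generator.sg7 I h) else 0

/-- The sign in `s_i s_I = ± s_{I ∪ {i}}` for `i ∉ I`. -/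
noncomputable def sgn (i : Fin k) (I : Finset (Fin k)) : ℝ := (-1) ^ (I.filter (· < i)).card

/-- Multiplication by `s_i` on `U_k^{>0}`, extended by `s_i w_j = 0`. -/
noncomputable def sOnGen (i : Fin k) : Generator k → Model k
  | .sg4 I _ => if i ∈ I then 0 else sgn i I • sg4 (insert i I)
  | .sg7 I _ => if i ∈ I then 0 else sgn i I • sg7 (insert i I)
  | .w _ => 0

theorem sg4_mem (I : Finset (Fin k)) : sg4 I ∈ homog (Generator.deg (k := k)) (4 - I.card) := by
  unfold sg4
  split_ifs with h
  · exact gen_mem_homog Generator.deg (Generator.sg4 I h)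
  · exact zero_mem _

theorem sg7_mem (I : Finset (Fin k)) : sg7 I ∈ homog (Generator.deg (k := k)) (7 - I.card) := by
  unfold sg7
  split_ifs with h
  · exact gen_mem_homog Generator.deg (Generator.sg7 I h)
  · exact zero_mem _

theorem w_mem (i : Fin k) : w i ∈ homog (Generator.deg (k := k)) 2 :=
  gen_mem_homog Generator.deg (Generator.w i)

theorem sOnGen_mem (i : Fin k) (a : Generator k) :
    sOnGen i a ∈ homog (Generator.deg (k := k)) (a.deg - 1) := by
  cases a with
  | sg4 I h =>
    simp only [sOnGen, Generator.deg]
    split_ifs with hi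
    · exact zero_mem _
    · refine Submodule.smul_mem _ _ ?_
      have := sg4_mem (insert i I)
      rwa [Finset.card_insert_of_notMem hi, ← Nat.sub_sub] at this
  | sg7 I h =>
    simp only [sOnGen, Generator.deg]
    split_ifs with hi
    · exact zero_mem _
    · refine Submodule.smul_mem _ _ ?_
      have := sg7_mem (insert i I)
      rwa [Finset.card_insert_of_notMem hi, ← Nat.sub_sub] at this
  | w j => exact zero_mem _

theorem sOnGen_parity (i : Fin k) (a : Generator k) :
    sOnGen i a ∈ parity (Generator.deg (k := k)) (a.deg + 1) := by
  have := a.deg_pos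
  refine homog_le_parity Generator.deg ?_ (sOnGen_mem i a)
  rw [Nat.ModEq]; omega

/-- The operator `s_i`, extended to the whole algebra as a derivation of degree `-1`. -/
noncomputable def s (i : Fin k) : Model k →ₗ[ℝ] Model k :=
  oddDeriv Generator.deg (sOnGen i) (sOnGen_parity i)

/-- The composite operator `s_I = s_{i₁} ∘ ⋯ ∘ s_{i_p}` for `I = {i₁ < ⋯ < i_p}`. -/
noncomputable def sWord (I : Finset (Fin k)) (x : Model k) : Model k :=
  (I.sort (· ≤ ·)).foldr (fun i y => s i y) x

theorem s_mem (i : Fin k) {n : ℕ} {x : Model k} (hx : x ∈ homog Generator.deg n) :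
    s i x ∈ homog (Generator.deg (k := k)) (n - 1) :=
  oddDeriv_down Generator.deg Generator.deg_pos _ _ (sOnGen_mem i) hx

theorem sWord_mem (I : Finset (Fin k)) {n : ℕ} {x : Model k} (hx : x ∈ homog Generator.deg n) :
    sWord I x ∈ homog (Generator.deg (k := k)) (n - I.card) := by
  have : ∀ l : List (Fin k), l.foldr (fun i y => s i y) x ∈
      homog (Generator.deg (k := k)) (n - l.length) := by
    intro l
    induction l with
    | nil => simpa using hx
    | cons a l ih =>
      have := s_mem a ih
      simpa [Nat.sub_sub] using this
  have h := this (I.sort (· ≤ ·))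
  rw [Finset.length_sort] at h
  exact h

/-- `d g₄ = ∑ w_i · s_i g₄`. -/
noncomputable def dg4 : Model k := ∑ i : Fin k, w i * s i (sg4 ∅)

/-- `d g₇ = -½ g₄² + ∑ w_i · s_i g₇`. -/
noncomputable def dg7 : Model k :=
  -((1 / 2 : ℝ) • sg4 ∅ ^ 2) + ∑ i : Fin k, w i * s i (sg7 ∅)

/-- The differential on generators, as forced by `d w_i = 0` and `[d, s_i] = 0`:
`d (s_I v) = (-1)^{|I|} s_I (d v)` for `v = g₄, g₇`. -/
noncomputable def dOnGen : Generator k → Model k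
  | .sg4 I _ => ((-1 : ℝ) ^ I.card) • sWord I dg4
  | .sg7 I _ => ((-1 : ℝ) ^ I.card) • sWord I dg7
  | .w _ => 0

theorem dg4_mem : (dg4 : Model k) ∈ homog Generator.deg 5 := by
  refine Submodule.sum_mem _ fun i _ => ?_
  have h := homog_mul Generator.deg (w_mem i) (s_mem i (sg4_mem ∅))
  rw [Finset.card_empty] at h
  exact h

theorem dg7_mem : (dg7 : Model k) ∈ homog Generator.deg 8 := by
  refine add_mem (neg_mem (Submodule.smul_mem _ _ ?_)) (Submodule.sum_mem _ fun i _ => ?_)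
  · have h := homog_mul Generator.deg (sg4_mem (k := k) ∅) (sg4_mem ∅)
    rw [Finset.card_empty, ← pow_two] at h
    exact h
  · have h := homog_mul Generator.deg (w_mem i) (s_mem i (sg7_mem ∅))
    rw [Finset.card_empty] at h
    exact h

theorem dOnGen_mem (a : Generator k) :
    dOnGen a ∈ homog (Generator.deg (k := k)) (a.deg + 1) := by
  cases a with
  | sg4 I h =>
    refine Submodule.smul_mem _ _ ?_
    have := sWord_mem I (dg4_mem (k := k))
    convert this using 2; simp only [Generator.deg]; omega
  | sg7 I h =>
    refine Submodule.smul_mem _ _ ?_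
    have := sWord_mem I (dg7_mem (k := k))
    convert this using 2; simp only [Generator.deg]; omega
  | w i => exact zero_mem _

/-- The differential of `M(T^k S⁴)`. It is characterized by `d_g4`, `d_g7`, `d_w`, `d_s` and `d_mul`,
and it squares to zero (`d_d`). -/
noncomputable def d (k : ℕ) : Model k →ₗ[ℝ] Model k :=
  oddDeriv Generator.deg dOnGen fun a => homog_le_parity Generator.deg rfl (dOnGen_mem a)

theorem d_mem {n : ℕ} {x : Model k} (hx : x ∈ homog Generator.deg n) :
    d k x ∈ homog (Generator.deg (k := k)) (n + 1) :=
  oddDeriv_up Generator.deg _ _ dOnGen_mem hx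

theorem s_sg4 (i : Fin k) (I : Finset (Fin k)) :
    s i (sg4 I) = if i ∈ I then 0 else sgn i I • sg4 (insert i I) := by
  by_cases h : I.card ≤ 3
  · simp [sg4, h, s, oddDeriv_gen, sOnGen]
  · have : i ∉ I → ¬ (insert i I).card ≤ 3 := fun hi => by
      rw [Finset.card_insert_of_notMem hi]; omega
    by_cases hi : i ∈ I
    · simp [sg4, h, hi]
    · rw [if_neg hi, sg4, sg4, dif_neg h, dif_neg (this hi), map_zero, smul_zero]

theorem s_sg7 (i : Fin k) (I : Finset (Fin k)) :
    s i (sg7 I) = if i ∈ I then 0 else sgn i I • sg7 (insert i I) := by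
  by_cases h : I.card ≤ 6
  · simp [sg7, h, s, oddDeriv_gen, sOnGen]
  · have : i ∉ I → ¬ (insert i I).card ≤ 6 := fun hi => by
      rw [Finset.card_insert_of_notMem hi]; omega
    by_cases hi : i ∈ I
    · simp [sg7, h, hi]
    · rw [if_neg hi, sg7, sg7, dif_neg h, dif_neg (this hi), map_zero, smul_zero]

theorem s_w (i j : Fin k) : s i (w j) = 0 := by
  simp [s, w, oddDeriv_gen, sOnGen]

theorem sgn_insert {i j : Fin k} {I : Finset (Fin k)} (hj : j ∉ I) :
    sgn i (insert j I) = if j < i then -sgn i I else sgn i I := by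
  unfold sgn
  rw [Finset.filter_insert]
  split_ifs with h
  · rw [Finset.card_insert_of_notMem (by simp [hj]), pow_succ]; simp
  · rfl

theorem sgn_swap {i j : Fin k} {I : Finset (Fin k)} (hij : i ≠ j) (hi : i ∉ I) (hj : j ∉ I) :
    sgn j I * sgn i (insert j I) = -(sgn i I * sgn j (insert i I)) := by
  rw [sgn_insert hi, sgn_insert hj]
  rcases lt_or_gt_of_ne hij with h | h
  · rw [if_neg h.asymm, if_pos h]; ring
  · rw [if_neg h.asymm, if_pos h]; ring

/-- The operators `s_i` anticommute. -/
theorem s_anticomm (i j : Fin k) (x : Model k) : s i (s j x) = -s j (s i x) := by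
  refine anticommute Generator.deg _ _ _ _ ?_ x
  intro a
  change s i (sOnGen j a) = -s j (sOnGen i a)
  cases a with
  | sg4 I h =>
    simp only [sOnGen]
    by_cases hi : i ∈ I <;> by_cases hj : j ∈ I <;> simp [hi, hj, s_sg4]
    by_cases hij : i = j
    · subst hij; simp
    · rw [if_neg (by tauto), if_neg (by tauto), smul_smul, smul_smul,
        sgn_swap hij hi hj, Finset.insert_comm, neg_smul]
  | sg7 I h =>
    simp only [sOnGen]
    by_cases hi : i ∈ I <;> by_cases hj : j ∈ I <;> simp [hi, hj, s_sg7]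
    by_cases hij : i = j
    · subst hij; simp
    · rw [if_neg (by tauto), if_neg (by tauto), smul_smul, smul_smul,
        sgn_swap hij hi hj, Finset.insert_comm, neg_smul]
  | w j => simp [sOnGen]

theorem s_s (i : Fin k) (x : Model k) : s i (s i x) = 0 := by
  have h := s_anticomm i i x
  have h2 : (2 : ℝ) • s i (s i x) = 0 := by
    rw [two_smul]; nth_rewrite 1 [h]; exact neg_add_cancel _
  exact (smul_eq_zero_iff_right two_ne_zero).mp h2

theorem sWord_empty (x : Model k) : sWord ∅ x = x := by simp [sWord]

theorem sWord_insert_min {a : Fin k} {I : Finset (Fin k)} (h : ∀ b ∈ I, a < b) (x : Model k) :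
    sWord (insert a I) x = s a (sWord I x) := by
  unfold sWord
  rw [Finset.sort_insert (· ≤ ·) (fun b hb => (h b hb).le) (fun ha => lt_irrefl _ (h a ha))]
  rfl

theorem s_sWord (i : Fin k) (I : Finset (Fin k)) (x : Model k) :
    s i (sWord I x) = if i ∈ I then 0 else sgn i I • sWord (insert i I) x := by
  induction I using Finset.induction_on_min with
  | empty => rw [sWord_empty, if_neg (by simp), sWord_insert_min (by simp), sWord_empty]; simp [sgn]
  | insert a J ha ih =>
    have haJ : a ∉ J := fun h => lt_irrefl _ (ha a h)
    rw [sWord_insert_min ha]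
    rcases lt_trichotomy i a with h | h | h
    · have hlt : ∀ b ∈ insert a J, i < b := by
        intro b hb
        rcases Finset.mem_insert.mp hb with rfl | hb
        · exact h
        · exact h.trans (ha b hb)
      have hn : i ∉ insert a J := fun hi => lt_irrefl _ (hlt i hi)
      have hs : sgn i (insert a J) = 1 := by
        unfold sgn
        rw [Finset.filter_false_of_mem (fun b hb => (hlt b hb).asymm)]; simp
      rw [if_neg hn, hs, one_smul, sWord_insert_min hlt, sWord_insert_min ha]
    · subst h; simp [s_s]
    · rw [s_anticomm, ih]
      by_cases hi : i ∈ J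
      · simp [hi]
      · have hlt : ∀ b ∈ insert i J, a < b := by
          intro b hb
          rcases Finset.mem_insert.mp hb with rfl | hb
          · exact h
          · exact ha b hb
        rw [if_neg hi, if_neg (by simp [hi, h.ne']), sgn_insert haJ, if_pos h, map_smul,
          Finset.insert_comm, sWord_insert_min hlt, neg_smul]

theorem sWord_sg4 (I : Finset (Fin k)) : sWord I (sg4 ∅) = sg4 I := by
  induction I using Finset.induction_on_min with
  | empty => exact sWord_empty _
  | insert a J ha ih =>
    rw [sWord_insert_min ha, ih, s_sg4, if_neg (fun h => lt_irrefl _ (ha a h))]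
    unfold sgn
    rw [Finset.filter_false_of_mem (fun b hb => (ha b hb).asymm)]; simp

theorem sWord_sg7 (I : Finset (Fin k)) : sWord I (sg7 ∅) = sg7 I := by
  induction I using Finset.induction_on_min with
  | empty => exact sWord_empty _
  | insert a J ha ih =>
    rw [sWord_insert_min ha, ih, s_sg7, if_neg (fun h => lt_irrefl _ (ha a h))]
    unfold sgn
    rw [Finset.filter_false_of_mem (fun b hb => (ha b hb).asymm)]; simp

theorem s_mul (i : Fin k) (x y : Model k) :
    s i (x * y) = s i x * y + signAut Generator.deg x * s i y :=
  oddDeriv_mul Generator.deg _ _ x y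

theorem d_mul (x y : Model k) :
    d k (x * y) = d k x * y + signAut Generator.deg x * d k y :=
  oddDeriv_mul Generator.deg _ _ x y

theorem d_w (i : Fin k) : d k (w i) = 0 := by
  simp [d, w, oddDeriv_gen, dOnGen]

theorem signAut_w (i : Fin k) : signAut Generator.deg (w i) = w i := by
  simp [w, signAut_gen, Generator.deg]

theorem s_w_mul (i j : Fin k) (x : Model k) : s i (w j * x) = w j * s i x := by
  rw [s_mul, s_w, signAut_w, zero_mul, zero_add]

theorem d_w_mul (j : Fin k) (x : Model k) : d k (w j * x) = w j * d k x := by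
  rw [d_mul, d_w, signAut_w, zero_mul, zero_add]

theorem w_mul_w (i j : Fin k) : w i * w j = w j * w i := by
  have := gen_mul_gen Generator.deg (Generator.w i) (Generator.w j)
  simpa [w, Generator.deg, (show ((-1 : ℝ) ^ 4) = 1 by norm_num)] using this

theorem sWord_zero (I : Finset (Fin k)) : sWord I 0 = 0 := by
  unfold sWord
  induction I.sort (· ≤ ·) with
  | nil => rfl
  | cons a l ih => simp [ih]

theorem sWord_add (I : Finset (Fin k)) (x y : Model k) :
    sWord I (x + y) = sWord I x + sWord I y := by
  unfold sWord
  induction I.sort (· ≤ ·) with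
  | nil => rfl
  | cons a l ih => simp [ih]

theorem sWord_smul (I : Finset (Fin k)) (r : ℝ) (x : Model k) :
    sWord I (r • x) = r • sWord I x := by
  unfold sWord
  induction I.sort (· ≤ ·) with
  | nil => rfl
  | cons a l ih => simp [ih]

theorem sWord_sum (I : Finset (Fin k)) (f : Fin k → Model k) :
    sWord I (∑ i, f i) = ∑ i, sWord I (f i) :=
  map_sum (⟨⟨sWord I, sWord_zero I⟩, sWord_add I⟩ : Model k →+ Model k) f Finset.univ

theorem sWord_w_mul (I : Finset (Fin k)) (j : Fin k) (x : Model k) :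
    sWord I (w j * x) = w j * sWord I x := by
  unfold sWord
  induction I.sort (· ≤ ·) with
  | nil => rfl
  | cons a l ih => simp only [List.foldr_cons, ih, s_w_mul]

theorem sWord_s (I : Finset (Fin k)) (j : Fin k) (x : Model k) :
    sWord I (s j x) = ((-1 : ℝ) ^ I.card) • s j (sWord I x) := by
  rw [← Finset.length_sort (· ≤ ·) (s := I)]
  unfold sWord
  induction I.sort (· ≤ ·) with
  | nil => simp
  | cons a l ih =>
    simp only [List.foldr_cons, ih, map_smul, List.length_cons, pow_succ]
    rw [s_anticomm, smul_neg, mul_neg_one, neg_smul]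

theorem sWord_dg4_eq_zero {I : Finset (Fin k)} (h : 3 < I.card) : sWord I dg4 = 0 := by
  rw [dg4, sWord_sum]
  refine Finset.sum_eq_zero fun i _ => ?_
  rw [sWord_w_mul, sWord_s, sWord_sg4]
  simp [sg4, not_le.mpr h]

/-- An auxiliary span used to see that the derived relations survive truncation. -/
noncomputable def quad (k n : ℕ) : Submodule ℝ (Model k) :=
  Submodule.span ℝ {x | ∃ A B : Finset (Fin k), A.card + B.card = n ∧ x = sg4 A * sg4 B}

theorem s_quad (i : Fin k) {n : ℕ} {x : Model k} (hx : x ∈ quad k n) : s i x ∈ quad k (n + 1) := by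
  induction hx using Submodule.span_induction with
  | mem x h =>
    obtain ⟨A, B, rfl, rfl⟩ := h
    rw [s_mul, s_sg4, s_sg4,
      signAut_of_mem Generator.deg (homog_le_parity Generator.deg rfl (sg4_mem A))]
    refine add_mem ?_ ?_
    · split_ifs with h
      · rw [zero_mul]; exact zero_mem _
      · rw [smul_mul_assoc]
        refine Submodule.smul_mem _ _ (Submodule.subset_span ⟨_, _, ?_, rfl⟩)
        rw [Finset.card_insert_of_notMem h]; omega
    · split_ifs with h
      · rw [mul_zero]; exact zero_mem _
      · rw [smul_mul_smul_comm]
        refine Submodule.smul_mem _ _ (Submodule.subset_span ⟨_, _, ?_, rfl⟩)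
        rw [Finset.card_insert_of_notMem h]; omega
  | zero => simp
  | add x y _ _ hx hy => rw [map_add]; exact add_mem hx hy
  | smul r x _ hx => rw [map_smul]; exact Submodule.smul_mem _ _ hx

theorem sWord_quad (I : Finset (Fin k)) {n : ℕ} {x : Model k} (hx : x ∈ quad k n) :
    sWord I x ∈ quad k (n + I.card) := by
  rw [← Finset.length_sort (· ≤ ·) (s := I)]
  unfold sWord
  induction I.sort (· ≤ ·) with
  | nil => simpa using hx
  | cons a l ih => exact s_quad a ih

theorem quad_eq_zero {n : ℕ} (hn : 6 < n) {x : Model k} (hx : x ∈ quad k n) : x = 0 := by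
  induction hx using Submodule.span_induction with
  | mem x h =>
    obtain ⟨A, B, hAB, rfl⟩ := h
    by_cases hA : A.card ≤ 3
    · rw [sg4, sg4, dif_neg (by omega : ¬ B.card ≤ 3), mul_zero]
    · rw [sg4, dif_neg hA, zero_mul]
  | zero => rfl
  | add x y _ _ hx hy => rw [hx, hy, add_zero]
  | smul r x _ hx => rw [hx, smul_zero]

theorem sWord_dg7_eq_zero {I : Finset (Fin k)} (h : 6 < I.card) : sWord I dg7 = 0 := by
  rw [dg7, ← neg_one_smul ℝ ((1 / 2 : ℝ) • sg4 (∅ : Finset (Fin k)) ^ 2), sWord_add, sWord_smul,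
    sWord_smul, sWord_sum]
  have h1 : sWord I (sg4 ∅ ^ 2) = 0 := by
    refine quad_eq_zero (n := 0 + I.card) (by omega) (sWord_quad I ?_)
    exact Submodule.subset_span ⟨∅, ∅, by simp, by rw [pow_two]⟩
  rw [h1, smul_zero, smul_zero, zero_add]
  refine Finset.sum_eq_zero fun i _ => ?_
  rw [sWord_w_mul, sWord_s, sWord_sg7]
  simp [sg7, not_le.mpr h]

theorem d_sg4 (I : Finset (Fin k)) : d k (sg4 I) = ((-1 : ℝ) ^ I.card) • sWord I dg4 := by
  by_cases h : I.card ≤ 3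
  · rw [sg4, dif_pos h, d, oddDeriv_gen, dOnGen]
  · rw [sg4, dif_neg h, map_zero, sWord_dg4_eq_zero (not_le.mp h), smul_zero]

theorem d_sg7 (I : Finset (Fin k)) : d k (sg7 I) = ((-1 : ℝ) ^ I.card) • sWord I dg7 := by
  by_cases h : I.card ≤ 6
  · rw [sg7, dif_pos h, d, oddDeriv_gen, dOnGen]
  · rw [sg7, dif_neg h, map_zero, sWord_dg7_eq_zero (not_le.mp h), smul_zero]

/-- `[d, sᵢ] = 0` in the graded sense. -/
theorem d_s (i : Fin k) (x : Model k) : d k (s i x) = -s i (d k x) := by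
  refine anticommute Generator.deg _ _ _ _ ?_ x
  intro a
  change d k (sOnGen i a) = -s i (dOnGen a)
  cases a with
  | sg4 I h =>
    simp only [sOnGen, dOnGen]
    rw [map_smul, s_sWord]
    split_ifs with hi
    · simp
    · rw [map_smul, d_sg4, Finset.card_insert_of_notMem hi, pow_succ, mul_neg_one, neg_smul,
        smul_neg, smul_comm]
  | sg7 I h =>
    simp only [sOnGen, dOnGen]
    rw [map_smul, s_sWord]
    split_ifs with hi
    · simp
    · rw [map_smul, d_sg7, Finset.card_insert_of_notMem hi, pow_succ, mul_neg_one, neg_smul,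
        smul_neg, smul_comm]
  | w j => simp [sOnGen, dOnGen]

/-- `d g₄ = ∑ wᵢ · sᵢ g₄`. -/
theorem d_g4 : d k (sg4 ∅) = ∑ i, w i * s i (sg4 ∅) := by
  rw [d_sg4, sWord_empty]; simp [dg4]

/-- `d g₇ = -½ g₄² + ∑ wᵢ · sᵢ g₇`. -/
theorem d_g7 : d k (sg7 ∅) = -((1 / 2 : ℝ) • sg4 ∅ ^ 2) + ∑ i, w i * s i (sg7 ∅) := by
  rw [d_sg7, sWord_empty]; simp [dg7]

theorem sum_w_w_s_s (x : Model k) : ∑ i, ∑ j, w i * (w j * s i (s j x)) = 0 := by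
  have h : ∑ i, ∑ j, w i * (w j * s i (s j x)) = -∑ i, ∑ j, w i * (w j * s i (s j x)) := by
    conv_lhs => rw [Finset.sum_comm]
    simp only [← Finset.sum_neg_distrib]
    refine Finset.sum_congr rfl fun i _ => Finset.sum_congr rfl fun j _ => ?_
    rw [s_anticomm, mul_neg, mul_neg, ← mul_assoc, ← mul_assoc, w_mul_w]
  have h2 : (2 : ℝ) • ∑ i, ∑ j, w i * (w j * s i (s j x)) = 0 := by
    rw [two_smul]; nth_rewrite 1 [h]; exact neg_add_cancel _
  exact (smul_eq_zero_iff_right two_ne_zero).mp h2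

theorem d_dg4 : d k dg4 = 0 := by
  rw [dg4, map_sum]
  simp only [d_w_mul, d_s, d_g4, map_sum, s_w_mul, mul_neg, Finset.mul_sum, Finset.sum_neg_distrib]
  rw [sum_w_w_s_s, neg_zero]

theorem g4_comm (x : Model k) : x * sg4 ∅ = sg4 ∅ * x := by
  induction x using FreeGC.induct with
  | hs r => exact Algebra.commutes r _
  | hg a =>
    have h := gen_mul_gen Generator.deg a (Generator.sg4 ∅ (by simp))
    have e : Generator.deg (Generator.sg4 (∅ : Finset (Fin k)) (by simp)) = 4 := rfl
    rw [e, mul_comm, pow_mul, (show ((-1 : ℝ) ^ 4) = 1 by norm_num), one_pow] at h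
    simpa [sg4] using h
  | hm x y hx hy => rw [mul_assoc, hy, ← mul_assoc, hx, mul_assoc]
  | ha x y hx hy => rw [add_mul, hx, hy, mul_add]

theorem signAut_g4 : signAut Generator.deg (sg4 (∅ : Finset (Fin k))) = sg4 ∅ := by
  simp [sg4, signAut_gen, Generator.deg, (show ((-1 : ℝ) ^ 4) = 1 by norm_num)]

theorem w_mul_comm (i : Fin k) (x : Model k) : x * w i = w i * x := by
  induction x using FreeGC.induct with
  | hs r => exact Algebra.commutes r _
  | hg a =>
    have h := gen_mul_gen Generator.deg a (Generator.w i)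
    have e : Generator.deg (Generator.w i) = 2 := rfl
    rw [e, mul_comm, pow_mul] at h
    simpa [w] using h
  | hm x y hx hy => rw [mul_assoc, hy, ← mul_assoc, hx, mul_assoc]
  | ha x y hx hy => rw [add_mul, hx, hy, mul_add]

theorem d_dg7 : d k dg7 = 0 := by
  have h1 : d k (sg4 ∅ ^ 2) = (2 : ℝ) • ∑ i, w i * (sg4 ∅ * s i (sg4 ∅)) := by
    rw [pow_two, d_mul, signAut_g4, g4_comm, ← two_smul ℝ, d_g4, Finset.mul_sum]
    simp only [← mul_assoc, w_mul_comm]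
  have h2 : ∀ i, s i (sg4 (∅ : Finset (Fin k)) ^ 2) = (2 : ℝ) • (sg4 ∅ * s i (sg4 ∅)) := by
    intro i
    rw [pow_two, s_mul, signAut_g4, g4_comm, ← two_smul ℝ]
  rw [dg7, map_add, map_neg, map_smul, h1, smul_smul, map_sum]
  simp only [d_w_mul, d_s, d_g7, map_add, map_neg, map_smul, h2, map_sum, s_w_mul, neg_add,
    neg_neg, mul_add, mul_neg, Finset.sum_add_distrib, Finset.mul_sum, Finset.sum_neg_distrib,
    sum_w_w_s_s]
  simp

/-- `d` is a differential. -/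
theorem d_d (x : Model k) : d k (d k x) = 0 := by
  have h : d k (d k x) = -d k (d k x) := by
    refine anticommute Generator.deg _ _ _ _ ?_ x
    intro a
    have hw : ∀ (I : Finset (Fin k)) (y : Model k), d k y = 0 → d k (sWord I y) = 0 := by
      intro I y hy
      unfold sWord
      induction I.sort (· ≤ ·) with
      | nil => exact hy
      | cons a l ih => rw [List.foldr_cons, d_s, ih, map_zero, neg_zero]
    have h0 : d k (dOnGen a) = 0 := by
      cases a with
      | sg4 I h => rw [dOnGen, map_smul, hw I _ d_dg4, smul_zero]
      | sg7 I h => rw [dOnGen, map_smul, hw I _ d_dg7, smul_zero]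
      | w j => rw [dOnGen, map_zero]
    change d k (dOnGen a) = -d k (dOnGen a)
    rw [h0, neg_zero]
  have h2 : (2 : ℝ) • d k (d k x) = 0 := by
    rw [two_smul]; nth_rewrite 1 [h]; exact neg_add_cancel _
  exact (smul_eq_zero_iff_right two_ne_zero).mp h2

end Model

section Automorphisms

/-- The group of automorphisms of the differential graded commutative algebra `M(T^k S⁴)`:
algebra automorphisms that preserve the degree and commute with the differential. -/
def AutModel (k : ℕ) : Subgroup (Model k ≃ₐ[ℝ] Model k) where
  carrier := {φ | (∀ n x, φ x ∈ homog Generator.deg n ↔ x ∈ homog Generator.deg n) ∧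
    ∀ x, φ (d k x) = d k (φ x)}
  one_mem' := ⟨fun _ _ => Iff.rfl, fun _ => rfl⟩
  mul_mem' {φ ψ} hφ hψ := ⟨fun n x => (hφ.1 n (ψ x)).trans (hψ.1 n x), fun x => by
    rw [AlgEquiv.mul_apply, AlgEquiv.mul_apply, hψ.2, hφ.2]⟩
  inv_mem' {φ} hφ := ⟨fun n x => by
      have h := hφ.1 n (φ⁻¹ x)
      rw [show φ (φ⁻¹ x) = x from φ.apply_symm_apply x] at h
      exact h.symm,
    fun x => φ.injective (by
      rw [hφ.2, show φ (φ⁻¹ (d k x)) = d k x from φ.apply_symm_apply _,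
        show φ (φ⁻¹ x) = x from φ.apply_symm_apply x])⟩

/-- The algebra of regular functions on `Aut M(T^k S⁴)`: it is generated by the matrix coefficients
`φ ↦ ℓ (φ x)` and `φ ↦ ℓ (φ⁻¹ x)`. -/
def AutModel.regular (k : ℕ) : Subalgebra ℝ (AutModel k → ℝ) :=
  Algebra.adjoin ℝ {F | ∃ (x : Model k) (ℓ : Model k →ₗ[ℝ] ℝ),
    (F = fun φ => ℓ (φ.1 x)) ∨ (F = fun φ => ℓ (φ⁻¹.1 x))}

end Automorphisms

section AlgebraicGroups

/-- A group `G` with an algebra `𝒪` of real functions on it is (the group of real points of) a real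
affine algebraic group: `𝒪` is finitely generated, the points of `G` are the real points of the
affine variety with coordinate ring `𝒪`, and multiplication and inversion are regular. -/
structure IsRealAlgebraicGroup {G : Type} [Group G] (𝒪 : Subalgebra ℝ (G → ℝ)) : Prop where
  fg : 𝒪.FG
  points : ∀ χ : 𝒪 →ₐ[ℝ] ℝ, ∃! g : G, ∀ F : 𝒪, χ F = F.1 g
  mul_regular : ∀ F ∈ 𝒪, (fun p : G × G => F (p.1 * p.2)) ∈
    Submodule.span ℝ {H : G × G → ℝ | ∃ A ∈ 𝒪, ∃ B ∈ 𝒪, H = fun p => A p.1 * B p.2}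
  inv_regular : ∀ F ∈ 𝒪, (fun g : G => F g⁻¹) ∈ 𝒪

/-- `θ : H → G` is a closed embedding of real algebraic groups: its comorphism maps the regular
functions on `G` onto the regular functions on `H`. -/
def IsClosedEmbedding {H G : Type} [Group H] [Group G] (𝒪H : Subalgebra ℝ (H → ℝ))
    (𝒪G : Subalgebra ℝ (G → ℝ)) (θ : H →* G) : Prop :=
  ∀ F : H → ℝ, F ∈ 𝒪H ↔ ∃ E ∈ 𝒪G, F = fun h => E (θ h)

/-- The regular functions on the real points `(ℝˣ)^r` of the split torus of rank `r`: the Laurent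
polynomials in the coordinates. -/
def torusRegular (r : ℕ) : Subalgebra ℝ ((Fin r → ℝˣ) → ℝ) :=
  Algebra.adjoin ℝ {F | ∃ i, (F = fun t => ((t i : ℝˣ) : ℝ)) ∨ (F = fun t => ((t i)⁻¹ : ℝ))}

/-- The regular functions on `𝔾_m(ℝ) × T_ℂ^k(ℝ)`, where `𝔾_m(ℝ) = ℝˣ` and `T_ℂ^k(ℝ) = (ℝˣ)^k` is the
split form of the complexification of `T^k = (S¹)^k`: the Laurent polynomials in the coordinates
`t₀` and `t₁, …, t_k`. -/
def gmTorusRegular (k : ℕ) : Subalgebra ℝ (ℝˣ × (Fin k → ℝˣ) → ℝ) :=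
  Algebra.adjoin ℝ ({fun t => (t.1 : ℝ), fun t => (t.1⁻¹ : ℝ)} ∪
    {F | ∃ i, (F = fun t => ((t.2 i : ℝˣ) : ℝ)) ∨ (F = fun t => ((t.2 i)⁻¹ : ℝ))})

/-- An `ℝ`-split torus in `G`: a closed algebraic subgroup isomorphic, as an algebraic group, to
`(ℝˣ)^r` for some `r`. -/
def IsSplitTorus {G : Type} [Group G] (𝒪 : Subalgebra ℝ (G → ℝ)) (T : Subgroup G) : Prop :=
  ∃ (r : ℕ) (θ : (Fin r → ℝˣ) →* G), Function.Injective θ ∧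
    IsClosedEmbedding (torusRegular r) 𝒪 θ ∧ θ.range = T

/-- A split torus of `G` that is not properly contained in another one. -/
def IsMaximalSplitTorus {G : Type} [Group G] (𝒪 : Subalgebra ℝ (G → ℝ)) (T : Subgroup G) : Prop :=
  IsSplitTorus 𝒪 T ∧ ∀ T' : Subgroup G, IsSplitTorus 𝒪 T' → T ≤ T' → T' = T

end AlgebraicGroups

section TorusAction

/-- The element `(t₀, t₁, …, t_k)` acts on the generators by the weights `t₀` on `g₄`, `t₀²` on `g₇`,
`t_i` on `w_i`, each `s_i` contributing `t_i⁻¹`; on the whole algebra, `t s_i t⁻¹ = t_i⁻¹ s_i`. -/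
structure ActsByWeights (k : ℕ) (θ : ℝˣ × (Fin k → ℝˣ) →* AutModel k) : Prop where
  on_sg4 : ∀ t I, (θ t).1 (sg4 I) = ((t.1 : ℝ) * ∏ i ∈ I, ((t.2 i)⁻¹ : ℝ)) • sg4 I
  on_sg7 : ∀ t I, (θ t).1 (sg7 I) = ((t.1 : ℝ) ^ 2 * ∏ i ∈ I, ((t.2 i)⁻¹ : ℝ)) • sg7 I
  on_w : ∀ t i, (θ t).1 (w i) = ((t.2 i : ℝˣ) : ℝ) • w i
  on_s : ∀ t i x, (θ t).1 (s i x) = ((t.2 i)⁻¹ : ℝ) • s i ((θ t).1 x)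

end TorusAction

end Toroidification

/-!
The algebra `M = M(T^k S⁴)` is finitely generated in positive degrees, so each homogeneous component
is finite-dimensional, and the coordinates of `φ (a)` and `φ⁻¹ (a)`, for the generators `a`, generate
the regular functions on `Aut M`. Hence `φ ↦ φ x` is a finite sum `∑ F_j(φ) y_j` with regular
coefficients, that is, it comes from `𝒪 ⊗ M` (`orbit_mem`, `orbitInv_mem`). A character `χ` of `𝒪`
turns such families into endomorphisms of `M` by evaluating the coefficients (`specialize`). The
families `φ` and `φ⁻¹` specialize to mutually inverse algebra automorphisms; these respect the degree
and the differential because these are linear conditions, so that `χ` is evaluation at a point of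
`Aut M` (`exists_point`).

The torus acts by scaling the generators, and `d` is equivariant since every term of `d g₄` and
`d g₇` has the same weight as `g₄` and `g₇`. The coordinates `t₀^{±1}`, `t_i^{±1}` are matrix
coefficients at `g₄` and `w_i`, and all matrix coefficients are Laurent polynomials, so that the
torus is closed (`isClosedEmbedding_torusAction`).

The heart is that the torus is its own centralizer (`mem_range_torusAction_of_commute`); maximality
follows, since split tori are commutative. A `φ` that commutes with the torus preserves its weight
spaces. The degree of a monomial is `4 e₀ + ∑ e_i + δ`, where `t₀^{e₀} ∏ t_i^{e_i}` is its weight and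
`δ` is the number of its factors `w_i` minus that of its factors `s_I g₇`. Therefore a word with the
degree and the weight of a generator is that generator (`eq_singleton_of_torusWeight_eq`), and `φ` is
diagonal on the generators. Comparing coefficients in `φ d = d φ` (`eigenvalue_insert`) expresses all
eigenvalues through those on `g₄` and on the `w_i`, which are the coordinates of a point of the torus.
-/

namespace Toroidification

/-! ### Scalings, tangent vectors and words in free graded commutative algebras -/

section FreeGradedCommutative

variable {ι : Type} {deg : ι → ℕ}

theorem FreeGC.algHom_ext {B : Type} [Semiring B] [Algebra ℝ B] {f g : FreeGC deg →ₐ[ℝ] B}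
    (h : ∀ a, f (gen deg a) = g (gen deg a)) : f = g := by
  ext x
  induction x using FreeGC.induct with
  | hs r => simp
  | hg a => exact h a
  | hm x y hx hy => rw [map_mul, map_mul, hx, hy]
  | ha x y hx hy => rw [map_add, map_add, hx, hy]

theorem word_nil : word deg [] = 1 := rfl

theorem word_cons (a : ι) (l : List ι) : word deg (a :: l) = gen deg a * word deg l := by
  simp [word]

theorem span_range_word : Submodule.span ℝ (Set.range (word deg)) = ⊤ := by
  rw [eq_top_iff]
  rintro x -
  induction x using FreeGC.induct with
  | hs r =>
    rw [Algebra.algebraMap_eq_smul_one]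
    exact Submodule.smul_mem _ _ (Submodule.subset_span ⟨[], rfl⟩)
  | hg a => exact Submodule.subset_span ⟨[a], by simp [word]⟩
  | hm x y hx hy =>
    have h := Submodule.mul_mem_mul hx hy
    rw [Submodule.span_mul_span] at h
    refine Submodule.span_mono ?_ h
    rintro _ ⟨_, ⟨l, rfl⟩, _, ⟨m, rfl⟩, rfl⟩
    exact ⟨l ++ m, word_append deg l m⟩
  | ha x y hx hy => exact add_mem hx hy

/-- If every generator has positive degree, a word of degree `n` has length at most `n`. -/
theorem finiteDimensional_homog [Finite ι] (hpos : ∀ a, 0 < deg a) (n : ℕ) :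
    FiniteDimensional ℝ (homog deg n) := by
  refine FiniteDimensional.span_of_finite ℝ (Set.Finite.subset
    ((List.finite_length_le ι n).image (word deg)) ?_)
  rintro _ ⟨l, hl, rfl⟩
  refine ⟨l, ?_, rfl⟩
  change l.length ≤ n
  rw [← hl]
  clear hl
  induction l with
  | nil => simp
  | cons a l ih =>
    have := hpos a
    simp only [List.length_cons, List.map_cons, List.sum_cons]
    omega

/-- The endomorphism of `S(V)` that multiplies the generator `a` by the scalar `c a`. -/
noncomputable def scale (c : ι → ℝ) : FreeGC deg →ₐ[ℝ] FreeGC deg :=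
  lift deg (fun a => c a • gen deg a) (by
    intro a b
    rw [smul_mul_smul_comm, smul_mul_smul_comm, gen_mul_gen deg a b, smul_comm,
      mul_comm (c a)])

@[simp]
theorem scale_gen (c : ι → ℝ) (a : ι) : scale c (gen deg a) = c a • gen deg a :=
  lift_gen _ _ _ _

theorem scale_word (c : ι → ℝ) (l : List ι) :
    scale c (word deg l) = (l.map c).prod • word deg l := by
  induction l with
  | nil => simp [word_nil]
  | cons a l ih => rw [word_cons, map_mul, scale_gen, ih, smul_mul_smul_comm]; simp

theorem scale_mem_homog (c : ι → ℝ) {n : ℕ} {x : FreeGC deg} (hx : x ∈ homog deg n) :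
    scale c x ∈ homog deg n := by
  induction hx using Submodule.span_induction with
  | mem x h =>
    obtain ⟨l, rfl, rfl⟩ := h
    rw [scale_word]
    exact Submodule.smul_mem _ _ (word_mem_homog deg l)
  | zero => simp
  | add x y _ _ hx hy => rw [map_add]; exact add_mem hx hy
  | smul r x _ hx => rw [map_smul]; exact Submodule.smul_mem _ _ hx

theorem scale_scale (c c' : ι → ℝ) (x : FreeGC deg) : scale c (scale c' x) = scale (c * c') x := by
  have : (scale c).comp (scale c') = scale (deg := deg) (c * c') :=
    FreeGC.algHom_ext fun a => by
      simp only [AlgHom.comp_apply, scale_gen, map_smul, smul_smul, Pi.mul_apply, mul_comm]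
  exact DFunLike.congr_fun this x

theorem scale_one (x : FreeGC deg) : scale 1 x = x := by
  have : scale 1 = AlgHom.id ℝ (FreeGC deg) := FreeGC.algHom_ext fun a => by
    rw [scale_gen, Pi.one_apply, one_smul, AlgHom.id_apply]
  exact DFunLike.congr_fun this x

theorem scale_signAut (c : ι → ℝ) (x : FreeGC deg) :
    scale c (signAut deg x) = signAut deg (scale c x) := by
  have : (scale c).comp (signAut deg) = (signAut deg).comp (scale c) :=
    FreeGC.algHom_ext fun a => by
      simp only [AlgHom.comp_apply, signAut_gen, scale_gen, map_smul]
      exact smul_comm _ _ _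
  exact DFunLike.congr_fun this x

/-- An odd derivation is homogeneous of weight `r` for a scaling as soon as it is so on
generators. -/
theorem scale_oddDeriv (c : ι → ℝ) (r : ℝ) (f : ι → FreeGC deg)
    (hf : ∀ a, f a ∈ parity deg (deg a + 1)) (h : ∀ a, scale c (f a) = (r * c a) • f a)
    (x : FreeGC deg) :
    scale c (oddDeriv deg f hf x) = r • oddDeriv deg f hf (scale c x) := by
  induction x using FreeGC.induct with
  | hs r => simp [oddDeriv_algebraMap]
  | hg a => rw [oddDeriv_gen, h, scale_gen, map_smul, oddDeriv_gen, smul_smul]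
  | hm x y hx hy =>
    simp only [oddDeriv_mul, map_add, map_mul, hx, hy, scale_signAut, smul_mul_assoc,
      mul_smul_comm, smul_add]
  | ha x y hx hy => simp only [map_add, hx, hy, smul_add]

/-- The algebra homomorphism to the dual numbers with `a ↦ u a + v a ε`: the real point `u` of
`S(V)`, which has to vanish on the odd generators, together with the tangent vector `v` at it.
Its two components provide the coordinates that separate the elements of `S(V)` needed here. -/
noncomputable def tangent (u v : ι → ℝ) (hu : ∀ a, Odd (deg a) → u a = 0) :
    FreeGC deg →ₐ[ℝ] DualNumber ℝ :=
  lift deg (fun a => TrivSqZeroExt.inl (u a) + TrivSqZeroExt.inr (v a)) (by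
    intro a b
    rcases Nat.even_or_odd (deg a * deg b) with h | h
    · rw [h.neg_one_pow, one_smul, mul_comm]
    · rw [Nat.odd_mul] at h
      rw [hu a h.1, hu b h.2]
      ext <;> simp)

@[simp]
theorem tangent_gen (u v : ι → ℝ) (hu : ∀ a, Odd (deg a) → u a = 0) (a : ι) :
    tangent u v hu (gen deg a) = TrivSqZeroExt.inl (u a) + TrivSqZeroExt.inr (v a) :=
  lift_gen _ _ _ _

/-- The coefficient of the generator `a`, a linear form that vanishes on decomposable elements. -/
noncomputable def coeffGen [DecidableEq ι] (a : ι) : FreeGC deg →ₗ[ℝ] ℝ :=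
  TrivSqZeroExt.sndHom ℝ ℝ ∘ₗ (tangent 0 (Pi.single a 1) fun _ _ => rfl).toLinearMap

@[simp]
theorem coeffGen_gen [DecidableEq ι] (a : ι) : coeffGen a (gen deg a) = 1 := by
  simp [coeffGen]

theorem gen_ne_zero (a : ι) : gen deg a ≠ 0 := by
  classical
  intro h
  have := coeffGen_gen (deg := deg) a
  rw [h, map_zero] at this
  exact zero_ne_one this

end FreeGradedCommutative

/-- A simultaneous eigenvector `x` in the span of simultaneous eigenvectors `v i` lies in the span
of those `v i` that have the same eigenvalues as `x`. -/
theorem mem_span_of_forall_eigenvector {V ι κ : Type*} [AddCommGroup V] [Module ℝ V]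
    (f : κ → V →ₗ[ℝ] V) (v : ι → V) (c : κ → ι → ℝ) (hv : ∀ j i, f j (v i) = c j i • v i)
    (μ : κ → ℝ) {S : Set ι} {x : V} (hx : x ∈ Submodule.span ℝ (v '' S))
    (hμ : ∀ j, f j x = μ j • x) :
    x ∈ Submodule.span ℝ (v '' {i ∈ S | ∀ j, c j i = μ j}) := by
  classical
  obtain ⟨F, hFS, hxF⟩ : ∃ F : Finset ι, (F : Set ι) ⊆ S ∧ x ∈ Submodule.span ℝ (v '' F) := by
    obtain ⟨T, hT, hxT⟩ := Submodule.mem_span_finite_of_mem_span hx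
    obtain ⟨F, hF, rfl⟩ := Finset.subset_set_image_iff.mp hT
    exact ⟨F, hF, by simpa using hxT⟩
  induction F using Finset.strongInduction with
  | H F ih =>
    by_cases hF : ∀ i ∈ F, ∀ j, c j i = μ j
    · exact Submodule.span_mono (Set.image_mono fun i hi =>
        (⟨hFS hi, hF i hi⟩ : i ∈ S ∧ ∀ j, c j i = μ j)) hxF
    · push Not at hF
      obtain ⟨i, hi, j, hj⟩ := hF
      refine ih (F.erase i) (Finset.erase_ssubset hi)
        ((Finset.coe_subset.mpr (Finset.erase_subset _ _)).trans hFS) ?_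
      -- The operator `f j - c j i` removes `v i` and multiplies `x` by a nonzero scalar.
      have key : ∀ y ∈ Submodule.span ℝ (v '' (F : Set ι)),
          f j y - c j i • y ∈ Submodule.span ℝ (v '' (F.erase i : Finset ι)) := by
        intro y hy
        induction hy using Submodule.span_induction with
        | mem y h =>
          obtain ⟨i', hi', rfl⟩ := h
          rw [hv, ← sub_smul]
          by_cases hii : i' = i
          · simp [hii]
          · exact Submodule.smul_mem _ _ (Submodule.subset_span
              ⟨i', Finset.mem_coe.mpr (Finset.mem_erase.mpr ⟨hii, hi'⟩), rfl⟩)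
        | zero => simp
        | add y z _ _ hy hz =>
          have := add_mem hy hz
          rw [map_add, smul_add]
          convert this using 1; abel
        | smul r y _ hy =>
          have := Submodule.smul_mem _ r hy
          rw [map_smul, smul_comm _ r, ← smul_sub]
          exact this
      have h := key x hxF
      rw [hμ, ← sub_smul] at h
      exact (Submodule.smul_mem_iff _ (sub_ne_zero.mpr hj.symm)).mp h

/-! ### Families of endomorphisms with coefficients in an algebra of functions -/

section MatrixCoefficients

open TensorProduct

variable {G M : Type} [Ring M] [Algebra ℝ M]

/-- The algebra `A ⊗ M`, for an algebra `A` of real functions on `G`, viewed as an algebra of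
functions from `G` to `M`: these are the finite sums `φ ↦ ∑ F_j(φ) y_j` with `F_j ∈ A`. -/
noncomputable def evalTensor (A : Subalgebra ℝ (G → ℝ)) : A ⊗[ℝ] M →ₐ[ℝ] (G → M) :=
  Algebra.TensorProduct.lift (((Algebra.ofId ℝ M).compLeft G).comp A.val)
    (Pi.constAlgHom ℝ G M) (by
      intro F y
      ext φ
      exact Algebra.commutes (F.1 φ) y)

@[simp]
theorem evalTensor_tmul (A : Subalgebra ℝ (G → ℝ)) (F : A) (y : M) (φ : G) :
    evalTensor A (F ⊗ₜ y) φ = F.1 φ • y := by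
  rw [Algebra.smul_def]
  exact congrFun (Algebra.TensorProduct.lift_tmul _ _ _ F y) φ

/-- Evaluation of the coefficients of an element of `A ⊗ M` at a character of `A`. -/
noncomputable def specialize {A : Subalgebra ℝ (G → ℝ)} (χ : A →ₐ[ℝ] ℝ) : A ⊗[ℝ] M →ₐ[ℝ] M :=
  Algebra.TensorProduct.lift ((Algebra.ofId ℝ M).comp χ) (AlgHom.id ℝ M) fun F y =>
    Algebra.commutes (χ F) y

@[simp]
theorem specialize_tmul {A : Subalgebra ℝ (G → ℝ)} (χ : A →ₐ[ℝ] ℝ) (F : A) (y : M) :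
    specialize χ (F ⊗ₜ y) = χ F • y := by
  rw [Algebra.smul_def]
  exact Algebra.TensorProduct.lift_tmul _ _ _ F y

/-- Specialization commutes with applying a linear form: this characterizes `specialize χ t` by the
function `evalTensor A t` alone (`specialize_congr`). -/
theorem exists_slice {A : Subalgebra ℝ (G → ℝ)} (χ : A →ₐ[ℝ] ℝ) (ℓ : M →ₗ[ℝ] ℝ) (t : A ⊗[ℝ] M) :
    ∃ F : A, (∀ φ, F.1 φ = ℓ (evalTensor A t φ)) ∧ χ F = ℓ (specialize χ t) := by
  induction t with
  | zero => exact ⟨0, by simp, by simp⟩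
  | tmul F y =>
    refine ⟨ℓ y • F, fun φ => ?_, ?_⟩
    · simp [mul_comm]
    · simp [mul_comm]
  | add t t' ht ht' =>
    obtain ⟨F, hF, hχ⟩ := ht
    obtain ⟨F', hF', hχ'⟩ := ht'
    exact ⟨F + F', fun φ => by simp [hF, hF'], by simp [hχ, hχ']⟩

theorem specialize_slice {A : Subalgebra ℝ (G → ℝ)} (χ : A →ₐ[ℝ] ℝ) (ℓ : M →ₗ[ℝ] ℝ)
    (t : A ⊗[ℝ] M) (F : A) (hF : ∀ φ, F.1 φ = ℓ (evalTensor A t φ)) :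
    χ F = ℓ (specialize χ t) := by
  obtain ⟨F', hF', h⟩ := exists_slice χ ℓ t
  rwa [show F = F' from Subtype.ext (funext fun φ => (hF φ).trans (hF' φ).symm)]

theorem comp_evalTensor_mem (A : Subalgebra ℝ (G → ℝ)) {f : G → M}
    (hf : f ∈ (evalTensor A).range) (ℓ : M →ₗ[ℝ] ℝ) : (fun φ => ℓ (f φ)) ∈ A := by
  obtain ⟨t, rfl⟩ := hf
  induction t with
  | zero =>
    convert A.zero_mem using 1
    ext φ
    simp
  | tmul F y =>
    convert A.smul_mem F.2 (ℓ y) using 1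
    ext φ
    simp [mul_comm]
  | add t t' ht ht' =>
    convert A.add_mem ht ht' using 1
    ext φ
    simp

theorem eq_of_forall_linearMap {V : Type*} [AddCommGroup V] [Module ℝ V] {y y' : V}
    (h : ∀ ℓ : V →ₗ[ℝ] ℝ, ℓ y = ℓ y') : y = y' := by
  rw [← sub_eq_zero, ← Module.forall_dual_apply_eq_zero_iff ℝ]
  intro ℓ
  rw [map_sub, h, sub_self]

theorem specialize_congr {A : Subalgebra ℝ (G → ℝ)} (χ : A →ₐ[ℝ] ℝ) {t t' : A ⊗[ℝ] M}
    (h : evalTensor A t = evalTensor A t') : specialize χ t = specialize χ t' := by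
  refine eq_of_forall_linearMap fun ℓ => ?_
  obtain ⟨F, hF, hχ⟩ := exists_slice χ ℓ t
  rw [← hχ]
  exact specialize_slice χ ℓ t' F fun φ => by rw [hF, h]

/-- A family `o` of endomorphisms of `M` indexed by `G`, with coefficients in `A`, can be
specialized at a character of `A`. -/
theorem exists_specialization {A : Subalgebra ℝ (G → ℝ)} (χ : A →ₐ[ℝ] ℝ) (o : M →ₐ[ℝ] (G → M))
    (ho : ∀ x, o x ∈ (evalTensor (M := M) A).range) :
    ∃ g : M →ₐ[ℝ] M, ∀ x t, evalTensor A t = o x → specialize χ t = g x := by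
  choose t ht using ho
  change ∀ x, evalTensor A (t x) = o x at ht
  refine ⟨AlgHom.ofLinearMap
    { toFun := fun x => specialize χ (t x)
      map_add' := fun x y => ?_
      map_smul' := fun r x => ?_ } ?_ ?_, fun x t' ht' => specialize_congr χ (ht'.trans (ht x).symm)⟩
  · rw [← map_add]
    exact specialize_congr χ (by rw [map_add, ht, ht, ht, map_add])
  · rw [RingHom.id_apply, ← map_smul]
    exact specialize_congr χ (by rw [map_smul, ht, ht, map_smul])
  · change specialize χ (t 1) = 1
    refine Eq.trans ?_ (map_one (specialize χ))
    exact specialize_congr χ ((ht 1).trans ((map_one o).trans (map_one (evalTensor A)).symm))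
  · intro x y
    change specialize χ (t (x * y)) = specialize χ (t x) * specialize χ (t y)
    rw [← map_mul]
    exact specialize_congr χ (by rw [map_mul, ht, ht, ht, map_mul])

/-- The specialization of a composite of families is the composite of the specializations. -/
theorem specialization_comp {A : Subalgebra ℝ (G → ℝ)} (χ : A →ₐ[ℝ] ℝ) (o : M →ₐ[ℝ] (G → M))
    (ho : ∀ x, o x ∈ (evalTensor (M := M) A).range) (g : M →ₐ[ℝ] M)
    (hg : ∀ x t, evalTensor A t = o x → specialize χ t = g x) (t : A ⊗[ℝ] M) :
    ∃ t' : A ⊗[ℝ] M, (∀ φ, evalTensor A t' φ = o (evalTensor A t φ) φ) ∧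
      specialize χ t' = g (specialize χ t) := by
  induction t with
  | zero => exact ⟨0, by simp, by simp⟩
  | tmul F y =>
    obtain ⟨u, hu⟩ := ho y
    change evalTensor A u = o y at hu
    refine ⟨(F ⊗ₜ 1) * u, fun φ => ?_, ?_⟩
    · rw [map_mul, Pi.mul_apply, evalTensor_tmul, evalTensor_tmul, hu, map_smul, Pi.smul_apply,
        smul_mul_assoc, one_mul]
    · rw [map_mul, specialize_tmul, specialize_tmul, hg y u hu, map_smul, smul_mul_assoc, one_mul]
  | add t t' ht ht' =>
    obtain ⟨u, hu, hχ⟩ := ht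
    obtain ⟨u', hu', hχ'⟩ := ht'
    exact ⟨u + u', fun φ => by simp [hu, hu'], by simp [hχ, hχ']⟩

/-- Two families that are pointwise inverse specialize to inverse endomorphisms. -/
theorem specialization_leftInverse {A : Subalgebra ℝ (G → ℝ)} (χ : A →ₐ[ℝ] ℝ)
    (o o' : M →ₐ[ℝ] (G → M)) (ho : ∀ x, o x ∈ (evalTensor (M := M) A).range)
    (ho' : ∀ x, o' x ∈ (evalTensor (M := M) A).range) (g g' : M →ₐ[ℝ] M)
    (hg : ∀ x t, evalTensor A t = o x → specialize χ t = g x)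
    (hg' : ∀ x t, evalTensor A t = o' x → specialize χ t = g' x)
    (h : ∀ φ x, o (o' x φ) φ = x) (x : M) : g (g' x) = x := by
  obtain ⟨t, ht⟩ := ho' x
  change evalTensor A t = o' x at ht
  obtain ⟨t', ht', hχ⟩ := specialization_comp χ o ho g hg t
  rw [← hg' x t ht, ← hχ]
  trans specialize χ ((1 : A) ⊗ₜ x)
  · refine specialize_congr χ ?_
    ext φ
    rw [ht', ht, h, evalTensor_tmul]
    simp
  · simp

end MatrixCoefficients

/-! ### The automorphism group is algebraic -/

section AlgebraicGroup

open TensorProduct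

variable {k : ℕ}

instance : Finite (Generator k) := by
  refine Finite.of_injective (β := (Finset (Fin k) ⊕ Finset (Fin k)) ⊕ Fin k)
    (fun | .sg4 I _ => .inl (.inl I) | .sg7 I _ => .inl (.inr I) | .w i => .inr i) ?_
  rintro (⟨I, _⟩ | ⟨I, _⟩ | i) (⟨J, _⟩ | ⟨J, _⟩ | j) h <;> simp_all

/-- The family `φ ↦ φ x` of endomorphisms of `M(T^k S⁴)`. -/
noncomputable def orbit (k : ℕ) : Model k →ₐ[ℝ] (AutModel k → Model k) :=
  AlgHom.pi fun φ : AutModel k => φ.1.toAlgHom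

/-- The family `φ ↦ φ⁻¹ x` of endomorphisms of `M(T^k S⁴)`. -/
noncomputable def orbitInv (k : ℕ) : Model k →ₐ[ℝ] (AutModel k → Model k) :=
  AlgHom.pi fun φ : AutModel k => φ⁻¹.1.toAlgHom

@[simp]
theorem orbitInv_apply (x : Model k) (φ : AutModel k) : orbitInv k x φ = φ⁻¹.1 x := rfl

theorem AutModel.apply_inv_apply (φ : AutModel k) (x : Model k) : φ.1 (φ⁻¹.1 x) = x :=
  φ.1.apply_symm_apply x

theorem AutModel.inv_apply_apply (φ : AutModel k) (x : Model k) : φ⁻¹.1 (φ.1 x) = x :=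
  φ.1.symm_apply_apply x

/-- A finite system of coordinates on `homog n`, extended to the whole model. -/
theorem exists_coordinates (k n : ℕ) : ∃ (m : ℕ) (ℓ : Fin m → Model k →ₗ[ℝ] ℝ)
    (e : Fin m → Model k), ∀ x ∈ homog Generator.deg n, x = ∑ j, ℓ j x • e j := by
  have := finiteDimensional_homog (deg := Generator.deg (k := k)) Generator.deg_pos n
  let b := Module.finBasis ℝ (homog (Generator.deg (k := k)) n)
  choose ℓ hℓ using fun j => LinearMap.exists_extend (b.coord j)
  refine ⟨_, ℓ, fun j => b j, fun x hx => ?_⟩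
  have h := congrArg Subtype.val (b.sum_repr ⟨x, hx⟩)
  have h' : ∀ j, ℓ j x = b.repr ⟨x, hx⟩ j := fun j => DFunLike.congr_fun (hℓ j) ⟨x, hx⟩
  simp only [h']
  refine h.symm.trans ?_
  rw [AddSubmonoidClass.coe_finsetSum]
  rfl

/-- The action of `Aut M` on `M` has coefficients in a finitely generated algebra `A` of regular
functions: the coordinates of the images of the generators. -/
theorem exists_coefficients (k : ℕ) : ∃ A ≤ AutModel.regular k, A.FG ∧
    (∀ x, orbit k x ∈ (evalTensor (M := Model k) A).range) ∧
    ∀ x, orbitInv k x ∈ (evalTensor (M := Model k) A).range := by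
  choose m ℓ e he using exists_coordinates k
  let ca : (Σ a : Generator k, Fin (m a.deg)) → AutModel k → ℝ :=
    fun p φ => ℓ p.1.deg p.2 (φ.1 (gen Generator.deg p.1))
  let cb : (Σ a : Generator k, Fin (m a.deg)) → AutModel k → ℝ :=
    fun p φ => ℓ p.1.deg p.2 (φ⁻¹.1 (gen Generator.deg p.1))
  let S : Set (AutModel k → ℝ) := Set.range ca ∪ Set.range cb
  have hS : S.Finite := (Set.finite_range _).union (Set.finite_range _)
  -- A family of algebra endomorphisms has coefficients in `A` if this holds on the generators.
  have key : ∀ o : Model k →ₐ[ℝ] (AutModel k → Model k),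
      (∀ a φ, o (gen _ a) φ ∈ homog Generator.deg a.deg) →
      (∀ a j, (fun φ => ℓ a.deg j (o (gen _ a) φ)) ∈ S) →
      ∀ x, o x ∈ (evalTensor (M := Model k) (Algebra.adjoin ℝ S)).range := by
    intro o h1 h2 x
    induction x using FreeGC.induct with
    | hs r => rw [AlgHom.commutes]; exact Subalgebra.algebraMap_mem _ r
    | hg a =>
      refine ⟨∑ j, (⟨_, Algebra.subset_adjoin (h2 a j)⟩ : Algebra.adjoin ℝ S) ⊗ₜ e a.deg j, ?_⟩
      change evalTensor (Algebra.adjoin ℝ S) _ = _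
      rw [map_sum]
      ext φ
      rw [Finset.sum_apply]
      simp only [evalTensor_tmul]
      exact (he _ _ (h1 a φ)).symm
    | hm x y hx hy => rw [map_mul]; exact mul_mem hx hy
    | ha x y hx hy => rw [map_add]; exact add_mem hx hy
  refine ⟨Algebra.adjoin ℝ S, Algebra.adjoin_mono ?_, ?_, key _ ?_ ?_, key _ ?_ ?_⟩
  · rintro F (⟨p, rfl⟩ | ⟨p, rfl⟩)
    · exact ⟨_, _, Or.inl rfl⟩
    · exact ⟨_, _, Or.inr rfl⟩
  · exact ⟨hS.toFinset, by simp⟩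
  · exact fun a φ => (φ.2.1 _ _).mpr (gen_mem_homog _ a)
  · exact fun a j => Or.inl ⟨⟨a, j⟩, rfl⟩
  · exact fun a φ => (φ⁻¹.2.1 _ _).mpr (gen_mem_homog _ a)
  · exact fun a j => Or.inr ⟨⟨a, j⟩, rfl⟩

theorem evalTensor_range_mono {G M : Type} [Ring M] [Algebra ℝ M] {A B : Subalgebra ℝ (G → ℝ)}
    (h : A ≤ B) : (evalTensor (M := M) A).range ≤ (evalTensor (M := M) B).range := by
  rintro _ ⟨t, rfl⟩
  refine ⟨Algebra.TensorProduct.map (Subalgebra.inclusion h) (AlgHom.id ℝ M) t, ?_⟩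
  have : (evalTensor B).comp (Algebra.TensorProduct.map (Subalgebra.inclusion h) (AlgHom.id ℝ M)) =
      evalTensor A := by
    ext x φ <;> simp
  exact DFunLike.congr_fun this t

theorem orbit_mem (x : Model k) :
    orbit k x ∈ (evalTensor (M := Model k) (AutModel.regular k)).range := by
  obtain ⟨A, hA, -, h, -⟩ := exists_coefficients k
  exact evalTensor_range_mono hA (h x)

theorem orbitInv_mem (x : Model k) :
    orbitInv k x ∈ (evalTensor (M := Model k) (AutModel.regular k)).range := by
  obtain ⟨A, hA, -, -, h⟩ := exists_coefficients k
  exact evalTensor_range_mono hA (h x)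

theorem regular_fg (k : ℕ) : (AutModel.regular k).FG := by
  obtain ⟨A, hA, hfg, h, h'⟩ := exists_coefficients k
  rwa [show AutModel.regular k = A from le_antisymm (Algebra.adjoin_le ?_) hA]
  rintro F ⟨x, ℓ, rfl | rfl⟩
  · exact comp_evalTensor_mem A (h x) ℓ
  · exact comp_evalTensor_mem A (h' x) ℓ

/-- Every real character of the algebra of regular functions is the evaluation at an automorphism:
the specialization of the family of all automorphisms at the character. Preservation of the degree
and of the differential are linear conditions, hence they survive the specialization. -/
theorem exists_point (χ : AutModel.regular k →ₐ[ℝ] ℝ) :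
    ∃ g : AutModel k, ∀ F : AutModel.regular k, χ F = F.1 g := by
  obtain ⟨g, hg⟩ := exists_specialization χ (orbit k) orbit_mem
  obtain ⟨g', hg'⟩ := exists_specialization χ (orbitInv k) orbitInv_mem
  have hgg' := specialization_leftInverse χ _ _ orbit_mem orbitInv_mem g g' hg hg'
    fun φ x => AutModel.apply_inv_apply φ x
  have hg'g := specialization_leftInverse χ _ _ orbitInv_mem orbit_mem g' g hg' hg
    fun φ x => AutModel.inv_apply_apply φ x
  have hF : ∀ (x : Model k) (ℓ : Model k →ₗ[ℝ] ℝ) (F : AutModel.regular k),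
      (∀ φ, F.1 φ = ℓ (φ.1 x)) → χ F = ℓ (g x) := by
    intro x ℓ F h
    obtain ⟨t, ht⟩ := orbit_mem x
    change evalTensor (AutModel.regular k) t = orbit k x at ht
    rw [← hg x t ht]
    exact specialize_slice χ ℓ t F fun φ => by rw [h, ht]; rfl
  have hF' : ∀ (x : Model k) (ℓ : Model k →ₗ[ℝ] ℝ) (F : AutModel.regular k),
      (∀ φ, F.1 φ = ℓ (φ⁻¹.1 x)) → χ F = ℓ (g' x) := by
    intro x ℓ F h
    obtain ⟨t, ht⟩ := orbitInv_mem x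
    change evalTensor (AutModel.regular k) t = orbitInv k x at ht
    rw [← hg' x t ht]
    exact specialize_slice χ ℓ t F fun φ => by rw [h, ht]; rfl
  have hdeg : ∀ n x, x ∈ homog Generator.deg n → g x ∈ homog Generator.deg n := by
    intro n x hx
    by_contra hgx
    obtain ⟨ℓ, hℓ, hle⟩ := Submodule.exists_le_ker_of_notMem hgx
    refine hℓ ?_
    rw [← hF x ℓ 0 fun φ => ?_, map_zero]
    exact (hle ((φ.2.1 n x).mpr hx)).symm
  have hdeg' : ∀ n x, x ∈ homog Generator.deg n → g' x ∈ homog Generator.deg n := by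
    intro n x hx
    by_contra hgx
    obtain ⟨ℓ, hℓ, hle⟩ := Submodule.exists_le_ker_of_notMem hgx
    refine hℓ ?_
    rw [← hF' x ℓ 0 fun φ => ?_, map_zero]
    exact (hle ((φ⁻¹.2.1 n x).mpr hx)).symm
  have hd : ∀ x, g (d k x) = d k (g x) := by
    intro x
    refine eq_of_forall_linearMap fun ℓ => ?_
    let F : AutModel.regular k :=
      ⟨fun φ => ℓ (φ.1 (d k x)), Algebra.subset_adjoin ⟨_, _, Or.inl rfl⟩⟩
    rw [← hF (d k x) ℓ F fun φ => rfl]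
    exact hF x (ℓ ∘ₗ d k) F fun φ => congrArg ℓ (φ.2.2 x)
  let γ : AutModel k := ⟨AlgEquiv.ofAlgHom g g' (AlgHom.ext hgg') (AlgHom.ext hg'g),
    fun n x => ⟨fun h => by simpa [hg'g] using hdeg' n _ h, hdeg n x⟩, hd⟩
  refine ⟨γ, ?_⟩
  rintro ⟨F, hFm⟩
  induction hFm using Algebra.adjoin_induction with
  | mem F h =>
    obtain ⟨x, ℓ, rfl | rfl⟩ := h
    · exact hF x ℓ _ fun φ => rfl
    · exact hF' x ℓ _ fun φ => rfl
  | algebraMap r => exact χ.commutes r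
  | add F F' hm hm' h h' =>
    refine (map_add χ ⟨F, hm⟩ ⟨F', hm'⟩).trans ?_
    rw [h, h']; rfl
  | mul F F' hm hm' h h' =>
    refine (map_mul χ ⟨F, hm⟩ ⟨F', hm'⟩).trans ?_
    rw [h, h']; rfl

theorem AutModel.ext_of_regular {g g' : AutModel k} (h : ∀ F ∈ AutModel.regular k, F g = F g') :
    g = g' := by
  refine Subtype.ext (AlgEquiv.ext fun x => eq_of_forall_linearMap fun ℓ => ?_)
  exact h (fun φ => ℓ (φ.1 x)) (Algebra.subset_adjoin ⟨x, ℓ, Or.inl rfl⟩)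

/-- The functions on `G × G` of the form `∑ A_j(p) B_j(q)` are closed under multiplication. -/
theorem mul_mem_span_products {G : Type} (A : Subalgebra ℝ (G → ℝ)) {H H' : G × G → ℝ}
    (h : H ∈ Submodule.span ℝ
      {H : G × G → ℝ | ∃ a ∈ A, ∃ b ∈ A, H = fun p => a p.1 * b p.2})
    (h' : H' ∈ Submodule.span ℝ
      {H : G × G → ℝ | ∃ a ∈ A, ∃ b ∈ A, H = fun p => a p.1 * b p.2}) :
    H * H' ∈ Submodule.span ℝ
      {H : G × G → ℝ | ∃ a ∈ A, ∃ b ∈ A, H = fun p => a p.1 * b p.2} := by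
  have := Submodule.mul_mem_mul h h'
  rw [Submodule.span_mul_span] at this
  refine Submodule.span_mono ?_ this
  rintro _ ⟨_, ⟨a, ha, b, hb, rfl⟩, _, ⟨a', ha', b', hb', rfl⟩, rfl⟩
  exact ⟨a * a', A.mul_mem ha ha', b * b', A.mul_mem hb hb', by
    ext p
    simp only [Pi.mul_apply]
    ring⟩

/-- If the families `o` and `f` have coefficients in `A`, then `(p, q) ↦ o (f q) p` has coefficients
in the functions on `G × G` of the form `∑ A_j(p) B_j(q)`. -/
theorem comp_mem_span_products {G M : Type} [Ring M] [Algebra ℝ M] (A : Subalgebra ℝ (G → ℝ))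
    (o : M →ₐ[ℝ] (G → M)) (ho : ∀ x, o x ∈ (evalTensor (M := M) A).range) {f : G → M}
    (hf : f ∈ (evalTensor (M := M) A).range) (ℓ : M →ₗ[ℝ] ℝ) :
    (fun p : G × G => ℓ (o (f p.2) p.1)) ∈ Submodule.span ℝ
      {H : G × G → ℝ | ∃ a ∈ A, ∃ b ∈ A, H = fun p => a p.1 * b p.2} := by
  obtain ⟨t, rfl⟩ := hf
  induction t with
  | zero => convert Submodule.zero_mem _ using 1; ext p; simp
  | tmul F y =>
    refine Submodule.subset_span ⟨_, comp_evalTensor_mem A (ho y) ℓ, F.1, F.2, ?_⟩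
    ext p
    simp [mul_comm]
  | add t t' ht ht' => convert add_mem ht ht' using 1; ext p; simp

theorem isRealAlgebraicGroup_autModel (k : ℕ) : IsRealAlgebraicGroup (AutModel.regular k) where
  fg := regular_fg k
  points χ := by
    obtain ⟨g, hg⟩ := exists_point χ
    refine ⟨g, hg, fun g' hg' => AutModel.ext_of_regular fun F hF => ?_⟩
    exact (hg' ⟨F, hF⟩).symm.trans (hg ⟨F, hF⟩)
  mul_regular F hF := by
    induction hF using Algebra.adjoin_induction with
    | mem F h =>
      obtain ⟨x, ℓ, rfl | rfl⟩ := h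
      · exact comp_mem_span_products _ (orbit k) orbit_mem (orbit_mem x) ℓ
      · have h := comp_mem_span_products _ (orbitInv k) orbitInv_mem (orbitInv_mem x) ℓ
        -- Inversion reverses the order of the factors.
        have hs : ∀ H ∈ Submodule.span ℝ {H : AutModel k × AutModel k → ℝ |
            ∃ a ∈ AutModel.regular k, ∃ b ∈ AutModel.regular k, H = fun p => a p.1 * b p.2},
            (fun p => H p.swap) ∈ Submodule.span ℝ {H : AutModel k × AutModel k → ℝ |
              ∃ a ∈ AutModel.regular k, ∃ b ∈ AutModel.regular k,
                H = fun p => a p.1 * b p.2} := by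
          intro H hH
          induction hH using Submodule.span_induction with
          | mem H h =>
            obtain ⟨a, ha, b, hb, rfl⟩ := h
            exact Submodule.subset_span ⟨b, hb, a, ha, by ext p; simp [mul_comm]⟩
          | zero => exact zero_mem _
          | add H H' _ _ h h' => exact add_mem h h'
          | smul r H _ h => exact Submodule.smul_mem _ r h
        convert hs _ h using 1
        ext p
        simp [mul_inv_rev]
    | algebraMap r =>
      refine Submodule.subset_span ⟨_, Subalgebra.algebraMap_mem _ r, 1, one_mem _, ?_⟩
      ext p
      simp
    | add F F' _ _ h h' => exact add_mem h h'
    | mul F F' _ _ h h' => exact mul_mem_span_products _ h h'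
  inv_regular F hF := by
    induction hF using Algebra.adjoin_induction with
    | mem F h =>
      obtain ⟨x, ℓ, rfl | rfl⟩ := h
      · exact Algebra.subset_adjoin ⟨x, ℓ, Or.inr rfl⟩
      · exact Algebra.subset_adjoin ⟨x, ℓ, Or.inl (by ext g; simp)⟩
    | algebraMap r => exact Subalgebra.algebraMap_mem _ r
    | add F F' _ _ h h' => exact add_mem h h'
    | mul F F' _ _ h h' => exact mul_mem h h'

end AlgebraicGroup

/-! ### The torus action -/

section Torus

variable {k : ℕ}

/-- The character by which `(t₀, t₁, …, t_k)` acts on a generator. -/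
noncomputable def torusWeight (t : ℝˣ × (Fin k → ℝˣ)) : Generator k → ℝ
  | .sg4 I _ => (t.1 : ℝ) * ∏ i ∈ I, ((t.2 i)⁻¹ : ℝ)
  | .sg7 I _ => (t.1 : ℝ) ^ 2 * ∏ i ∈ I, ((t.2 i)⁻¹ : ℝ)
  | .w i => (t.2 i : ℝ)

theorem torusWeight_mul (t t' : ℝˣ × (Fin k → ℝˣ)) :
    torusWeight (t * t') = torusWeight t * torusWeight t' := by
  ext a
  cases a <;>
    simp only [torusWeight, Pi.mul_apply, Prod.fst_mul, Prod.snd_mul, Units.val_mul, mul_inv,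
      Finset.prod_mul_distrib] <;> ring

theorem torusWeight_one : torusWeight (1 : ℝˣ × (Fin k → ℝˣ)) = 1 := by
  ext a
  cases a <;> simp [torusWeight]

theorem scale_sg4 (t : ℝˣ × (Fin k → ℝˣ)) (I : Finset (Fin k)) :
    scale (torusWeight t) (sg4 I) = ((t.1 : ℝ) * ∏ i ∈ I, ((t.2 i)⁻¹ : ℝ)) • sg4 I := by
  unfold sg4
  split_ifs
  · exact scale_gen _ _
  · simp

theorem scale_sg7 (t : ℝˣ × (Fin k → ℝˣ)) (I : Finset (Fin k)) :
    scale (torusWeight t) (sg7 I) = ((t.1 : ℝ) ^ 2 * ∏ i ∈ I, ((t.2 i)⁻¹ : ℝ)) • sg7 I := by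
  unfold sg7
  split_ifs
  · exact scale_gen _ _
  · simp

theorem scale_w (t : ℝˣ × (Fin k → ℝˣ)) (i : Fin k) :
    scale (torusWeight t) (w i) = (t.2 i : ℝ) • w i :=
  scale_gen _ _

theorem scale_s (t : ℝˣ × (Fin k → ℝˣ)) (i : Fin k) (x : Model k) :
    scale (torusWeight t) (s i x) = ((t.2 i)⁻¹ : ℝ) • s i (scale (torusWeight t) x) := by
  refine scale_oddDeriv _ _ _ _ (fun a => ?_) x
  cases a with
  | sg4 I h =>
    simp only [sOnGen, torusWeight]
    split_ifs with hi
    · simp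
    · rw [map_smul, scale_sg4, Finset.prod_insert hi, mul_left_comm, smul_comm]
  | sg7 I h =>
    simp only [sOnGen, torusWeight]
    split_ifs with hi
    · simp
    · rw [map_smul, scale_sg7, Finset.prod_insert hi, mul_left_comm, smul_comm]
  | w j => simp [sOnGen]

theorem scale_sWord (t : ℝˣ × (Fin k → ℝˣ)) (I : Finset (Fin k)) (x : Model k) :
    scale (torusWeight t) (sWord I x) =
      (∏ i ∈ I, ((t.2 i)⁻¹ : ℝ)) • sWord I (scale (torusWeight t) x) := by
  induction I using Finset.induction_on_min with
  | empty => simp [sWord_empty]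
  | insert a J ha ih =>
    rw [sWord_insert_min ha, scale_s, ih, sWord_insert_min ha, map_smul, smul_smul,
      Finset.prod_insert fun h => lt_irrefl _ (ha a h)]

theorem scale_w_mul_s (t : ℝˣ × (Fin k → ℝˣ)) (i : Fin k) (x : Model k) :
    scale (torusWeight t) (w i * s i x) = w i * s i (scale (torusWeight t) x) := by
  rw [map_mul, scale_w, scale_s, smul_mul_smul_comm, mul_inv_cancel₀ (t.2 i).ne_zero, one_smul]

theorem scale_dg4 (t : ℝˣ × (Fin k → ℝˣ)) :
    scale (torusWeight t) dg4 = (t.1 : ℝ) • (dg4 : Model k) := by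
  simp only [dg4, map_sum, scale_w_mul_s, scale_sg4, Finset.prod_empty, mul_one, map_smul,
    mul_smul_comm, Finset.smul_sum]

theorem scale_dg7 (t : ℝˣ × (Fin k → ℝˣ)) :
    scale (torusWeight t) dg7 = (t.1 : ℝ) ^ 2 • (dg7 : Model k) := by
  simp only [dg7, map_add, map_neg, map_pow, map_sum, scale_w_mul_s, scale_sg4, scale_sg7,
    Finset.prod_empty, mul_one, map_smul, mul_smul_comm, Finset.smul_sum, smul_add, smul_neg,
    smul_pow]
  rw [smul_comm]

theorem scale_d (t : ℝˣ × (Fin k → ℝˣ)) (x : Model k) :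
    scale (torusWeight t) (d k x) = d k (scale (torusWeight t) x) := by
  rw [← one_smul ℝ (d k (scale (torusWeight t) x))]
  refine scale_oddDeriv _ _ _ _ (fun a => ?_) x
  cases a with
  | sg4 I h =>
    simp only [dOnGen, torusWeight]
    rw [map_smul, scale_sWord, scale_dg4, sWord_smul]
    simp only [smul_smul]
    congr 1
    ring
  | sg7 I h =>
    simp only [dOnGen, torusWeight]
    rw [map_smul, scale_sWord, scale_dg7, sWord_smul]
    simp only [smul_smul]
    congr 1
    ring
  | w j => simp [dOnGen]

theorem scale_torusWeight_inv (t : ℝˣ × (Fin k → ℝˣ)) (x : Model k) :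
    scale (torusWeight t) (scale (torusWeight t⁻¹) x) = x := by
  rw [scale_scale, ← torusWeight_mul, mul_inv_cancel, torusWeight_one, scale_one]

theorem scale_inv_torusWeight (t : ℝˣ × (Fin k → ℝˣ)) (x : Model k) :
    scale (torusWeight t⁻¹) (scale (torusWeight t) x) = x := by
  simpa using scale_torusWeight_inv t⁻¹ x

/-- The action of the torus `ℝˣ × (ℝˣ)^k` on `M(T^k S⁴)`. -/
noncomputable def torusAction (k : ℕ) : ℝˣ × (Fin k → ℝˣ) →* AutModel k where
  toFun t := ⟨AlgEquiv.ofAlgHom (scale (torusWeight t)) (scale (torusWeight t⁻¹))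
      (AlgHom.ext (scale_torusWeight_inv t)) (AlgHom.ext (scale_inv_torusWeight t)),
    fun _ x => ⟨fun h => scale_inv_torusWeight t x ▸ scale_mem_homog (torusWeight t⁻¹) h,
      scale_mem_homog _⟩,
    scale_d t⟩
  map_one' := Subtype.ext (AlgEquiv.ext fun x => by
    change scale (torusWeight 1) x = x
    rw [torusWeight_one, scale_one])
  map_mul' t t' := Subtype.ext (AlgEquiv.ext fun x => by
    change scale (torusWeight (t * t')) x = scale (torusWeight t) (scale (torusWeight t') x)
    rw [torusWeight_mul, scale_scale])

theorem torusAction_apply (t : ℝˣ × (Fin k → ℝˣ)) (x : Model k) :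
    (torusAction k t).1 x = scale (torusWeight t) x := rfl

theorem actsByWeights_torusAction (k : ℕ) : ActsByWeights k (torusAction k) where
  on_sg4 := scale_sg4
  on_sg7 := scale_sg7
  on_w := scale_w
  on_s := scale_s

theorem AutModel.ext_gen {φ ψ : AutModel k}
    (h : ∀ a, φ.1 (gen Generator.deg a) = ψ.1 (gen Generator.deg a)) : φ = ψ := by
  have : (φ.1 : Model k →ₐ[ℝ] Model k) = ψ.1 := FreeGC.algHom_ext h
  exact Subtype.ext (AlgEquiv.ext fun x => DFunLike.congr_fun this x)

theorem sg4_of_card_le {I : Finset (Fin k)} (h : I.card ≤ 3) :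
    sg4 I = gen Generator.deg (Generator.sg4 I h) := dif_pos h

theorem sg7_of_card_le {I : Finset (Fin k)} (h : I.card ≤ 6) :
    sg7 I = gen Generator.deg (Generator.sg7 I h) := dif_pos h

theorem eq_torusAction {θ : ℝˣ × (Fin k → ℝˣ) →* AutModel k} (h : ActsByWeights k θ) :
    θ = torusAction k := by
  refine MonoidHom.ext fun t => AutModel.ext_gen fun a => ?_
  rw [torusAction_apply]
  cases a with
  | sg4 I hI => rw [← sg4_of_card_le, h.on_sg4, scale_sg4]
  | sg7 I hI => rw [← sg7_of_card_le, h.on_sg7, scale_sg7]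
  | w i =>
    change (θ t).1 (w i) = scale _ (w i)
    rw [h.on_w, scale_w]

theorem coeffGen_torusAction [DecidableEq (Generator k)] (t : ℝˣ × (Fin k → ℝˣ))
    (a : Generator k) :
    coeffGen a ((torusAction k t).1 (gen Generator.deg a)) = torusWeight t a := by
  rw [torusAction_apply, scale_gen, map_smul, coeffGen_gen, smul_eq_mul, mul_one]

theorem torusAction_injective (k : ℕ) : Function.Injective (torusAction k) := by
  classical
  intro t t' h
  have hw : ∀ a, torusWeight t a = torusWeight t' a := fun a => by
    rw [← coeffGen_torusAction, h, coeffGen_torusAction]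
  refine Prod.ext (Units.ext ?_) (funext fun i => Units.ext (hw (.w i)))
  simpa [torusWeight] using hw (.sg4 ∅ (by simp))

theorem torusWeight_mem (a : Generator k) : (fun t => torusWeight t a) ∈ gmTorusRegular k := by
  have h0 : (fun t : ℝˣ × (Fin k → ℝˣ) => (t.1 : ℝ)) ∈ gmTorusRegular k :=
    Algebra.subset_adjoin (Or.inl (Or.inl rfl))
  have hi : ∀ I : Finset (Fin k),
      (fun t : ℝˣ × (Fin k → ℝˣ) => ∏ i ∈ I, ((t.2 i)⁻¹ : ℝ)) ∈ gmTorusRegular k := by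
    intro I
    convert Subalgebra.prod_mem (gmTorusRegular k) (t := I)
      (f := fun i (t : ℝˣ × (Fin k → ℝˣ)) => ((t.2 i)⁻¹ : ℝ))
      (fun i _ => Algebra.subset_adjoin (Or.inr ⟨i, Or.inr rfl⟩)) using 1
    ext t
    simp
  cases a with
  | sg4 I h => exact mul_mem h0 (hi I)
  | sg7 I h => exact mul_mem (pow_mem h0 2) (hi I)
  | w i => exact Algebra.subset_adjoin (Or.inr ⟨i, Or.inl rfl⟩)

/-- The matrix coefficients of the torus action are Laurent polynomials. -/
theorem comp_torusAction_mem (x : Model k) (ℓ : Model k →ₗ[ℝ] ℝ) :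
    (fun t => ℓ ((torusAction k t).1 x)) ∈ gmTorusRegular k := by
  have hx : x ∈ Submodule.span ℝ (Set.range (word Generator.deg)) := by
    rw [span_range_word]; trivial
  simp only [torusAction_apply]
  induction hx using Submodule.span_induction with
  | mem x h =>
    obtain ⟨l, rfl⟩ := h
    have hl : (fun t : ℝˣ × (Fin k → ℝˣ) => (l.map (torusWeight t)).prod) ∈ gmTorusRegular k := by
      induction l with
      | nil => exact one_mem _
      | cons a l ih =>
        simp only [List.map_cons, List.prod_cons]
        exact mul_mem (torusWeight_mem a) ih
    convert Subalgebra.smul_mem _ hl (ℓ (word Generator.deg l)) using 1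
    ext t
    simp [scale_word, mul_comm]
  | zero =>
    simp only [map_zero]
    exact zero_mem (gmTorusRegular k)
  | add x y _ _ hx hy =>
    simp only [map_add]
    exact add_mem hx hy
  | smul r x _ hx =>
    simp only [map_smul]
    exact Subalgebra.smul_mem _ hx r

theorem gmTorusRegular_inv {F : ℝˣ × (Fin k → ℝˣ) → ℝ} (hF : F ∈ gmTorusRegular k) :
    (fun t => F t⁻¹) ∈ gmTorusRegular k := by
  induction hF using Algebra.adjoin_induction with
  | mem F h =>
    rcases h with (rfl | rfl) | ⟨i, rfl | rfl⟩
    · exact Algebra.subset_adjoin (Or.inl (Or.inr (by ext t; simp)))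
    · exact Algebra.subset_adjoin (Or.inl (Or.inl (by ext t; simp)))
    · exact Algebra.subset_adjoin (Or.inr ⟨i, Or.inr (by ext t; simp)⟩)
    · exact Algebra.subset_adjoin (Or.inr ⟨i, Or.inl (by ext t; simp)⟩)
  | algebraMap r => exact Subalgebra.algebraMap_mem _ r
  | add F F' _ _ h h' => exact add_mem h h'
  | mul F F' _ _ h h' => exact mul_mem h h'

theorem isClosedEmbedding_torusAction (k : ℕ) :
    IsClosedEmbedding (gmTorusRegular k) (AutModel.regular k) (torusAction k) := by
  classical
  intro F
  constructor
  · intro hF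
    induction hF using Algebra.adjoin_induction with
    | mem F h =>
      -- The coordinates and their inverses are matrix coefficients at `g₄` and at the `wᵢ`.
      rcases h with (rfl | rfl) | ⟨i, rfl | rfl⟩
      · refine ⟨_, Algebra.subset_adjoin ⟨gen _ (.sg4 ∅ (by simp)),
          coeffGen (.sg4 ∅ (by simp)), Or.inl rfl⟩, ?_⟩
        ext t
        rw [coeffGen_torusAction]
        simp [torusWeight]
      · refine ⟨_, Algebra.subset_adjoin ⟨gen _ (.sg4 ∅ (by simp)),
          coeffGen (.sg4 ∅ (by simp)), Or.inr rfl⟩, ?_⟩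
        ext t
        rw [← map_inv, coeffGen_torusAction]
        simp [torusWeight]
      · refine ⟨_, Algebra.subset_adjoin ⟨gen _ (.w i), coeffGen (.w i), Or.inl rfl⟩, ?_⟩
        ext t
        rw [coeffGen_torusAction]
        simp [torusWeight]
      · refine ⟨_, Algebra.subset_adjoin ⟨gen _ (.w i), coeffGen (.w i), Or.inr rfl⟩, ?_⟩
        ext t
        rw [← map_inv, coeffGen_torusAction]
        simp [torusWeight]
    | algebraMap r => exact ⟨_, Subalgebra.algebraMap_mem _ r, rfl⟩
    | add F F' _ _ h h' =>
      obtain ⟨E, hE, rfl⟩ := h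
      obtain ⟨E', hE', rfl⟩ := h'
      exact ⟨_, add_mem hE hE', rfl⟩
    | mul F F' _ _ h h' =>
      obtain ⟨E, hE, rfl⟩ := h
      obtain ⟨E', hE', rfl⟩ := h'
      exact ⟨_, mul_mem hE hE', rfl⟩
  · rintro ⟨E, hE, rfl⟩
    induction hE using Algebra.adjoin_induction with
    | mem F h =>
      obtain ⟨x, ℓ, rfl | rfl⟩ := h
      · exact comp_torusAction_mem x ℓ
      · simpa using gmTorusRegular_inv (comp_torusAction_mem x ℓ)
    | algebraMap r => exact Subalgebra.algebraMap_mem _ r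
    | add F F' _ _ h h' => exact add_mem h h'
    | mul F F' _ _ h h' => exact mul_mem h h'

/-- The isomorphism `(ℝˣ)^(k+1) ≃ ℝˣ × (ℝˣ)^k` that splits off the first coordinate. -/
def splitFirst (k : ℕ) : (Fin (k + 1) → ℝˣ) ≃* ℝˣ × (Fin k → ℝˣ) where
  toFun t := (t 0, fun i => t i.succ)
  invFun p := Fin.cons p.1 p.2
  left_inv t := by
    ext i
    refine Fin.cases ?_ (fun j => ?_) i <;> simp
  right_inv p := by simp
  map_mul' t t' := rfl

theorem comp_splitFirst_mem {F : ℝˣ × (Fin k → ℝˣ) → ℝ} (hF : F ∈ gmTorusRegular k) :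
    (fun t => F (splitFirst k t)) ∈ torusRegular (k + 1) := by
  induction hF using Algebra.adjoin_induction with
  | mem F h =>
    rcases h with (rfl | rfl) | ⟨i, rfl | rfl⟩
    · exact Algebra.subset_adjoin ⟨0, Or.inl rfl⟩
    · exact Algebra.subset_adjoin ⟨0, Or.inr rfl⟩
    · exact Algebra.subset_adjoin ⟨i.succ, Or.inl rfl⟩
    · exact Algebra.subset_adjoin ⟨i.succ, Or.inr rfl⟩
  | algebraMap r => exact Subalgebra.algebraMap_mem _ r
  | add F F' _ _ h h' => exact add_mem h h'
  | mul F F' _ _ h h' => exact mul_mem h h'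

theorem comp_splitFirst_symm_mem {F : (Fin (k + 1) → ℝˣ) → ℝ} (hF : F ∈ torusRegular (k + 1)) :
    (fun p => F ((splitFirst k).symm p)) ∈ gmTorusRegular k := by
  induction hF using Algebra.adjoin_induction with
  | mem F h =>
    obtain ⟨i, h⟩ := h
    refine Fin.cases (fun h => ?_) (fun j h => ?_) i h
    · rcases h with rfl | rfl
      · exact Algebra.subset_adjoin (Or.inl (Or.inl rfl))
      · exact Algebra.subset_adjoin (Or.inl (Or.inr rfl))
    · rcases h with rfl | rfl
      · exact Algebra.subset_adjoin (Or.inr ⟨j, Or.inl rfl⟩)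
      · exact Algebra.subset_adjoin (Or.inr ⟨j, Or.inr rfl⟩)
  | algebraMap r => exact Subalgebra.algebraMap_mem _ r
  | add F F' _ _ h h' => exact add_mem h h'
  | mul F F' _ _ h h' => exact mul_mem h h'

theorem isSplitTorus_range_torusAction (k : ℕ) :
    IsSplitTorus (AutModel.regular k) (torusAction k).range := by
  refine ⟨k + 1, (torusAction k).comp (splitFirst k).toMonoidHom,
    (torusAction_injective k).comp (splitFirst k).injective, fun F => ?_, ?_⟩
  · constructor
    · intro hF
      obtain ⟨E, hE, h⟩ := (isClosedEmbedding_torusAction k _).mp (comp_splitFirst_symm_mem hF)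
      refine ⟨E, hE, funext fun t => ?_⟩
      simpa using congrFun h (splitFirst k t)
    · rintro ⟨E, hE, rfl⟩
      exact comp_splitFirst_mem ((isClosedEmbedding_torusAction k _).mpr ⟨E, hE, rfl⟩)
  · rw [MonoidHom.range_eq_map, ← Subgroup.map_map]
    rw [← MonoidHom.range_eq_map (splitFirst k).toMonoidHom,
      MonoidHom.range_eq_top.mpr (splitFirst k).surjective, ← MonoidHom.range_eq_map]

end Torus

/-! ### The centralizer of the torus -/

section Centralizer

variable {k : ℕ}

/-- The exponent of `t₀` in `torusWeight`. -/
def Generator.exponentZero : Generator k → ℤ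
  | .sg4 _ _ => 1
  | .sg7 _ _ => 2
  | .w _ => 0

/-- The exponent of `t_i` in `torusWeight`. -/
def Generator.exponent (i : Fin k) : Generator k → ℤ
  | .sg4 I _ => if i ∈ I then -1 else 0
  | .sg7 I _ => if i ∈ I then -1 else 0
  | .w j => if i = j then 1 else 0

theorem torusWeight_eq (t : ℝˣ × (Fin k → ℝˣ)) (a : Generator k) :
    torusWeight t a = (t.1 : ℝ) ^ a.exponentZero * ∏ i, (t.2 i : ℝ) ^ a.exponent i := by
  cases a with
  | sg4 I h => simp [torusWeight, Generator.exponentZero, Generator.exponent, pow_ite]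
  | sg7 I h => simp [torusWeight, Generator.exponentZero, Generator.exponent, pow_ite]
  | w j => simp [torusWeight, Generator.exponentZero, Generator.exponent, pow_ite]

theorem prod_map_torusWeight (t : ℝˣ × (Fin k → ℝˣ)) (l : List (Generator k)) :
    (l.map (torusWeight t)).prod = (t.1 : ℝ) ^ (l.map Generator.exponentZero).sum *
      ∏ i, (t.2 i : ℝ) ^ (l.map (Generator.exponent i)).sum := by
  induction l with
  | nil => simp
  | cons a l ih =>
    simp only [List.map_cons, List.prod_cons, List.sum_cons, ih, torusWeight_eq,
      zpow_add₀ (Units.ne_zero _), Finset.prod_mul_distrib]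
    ring

/-- A word with the character of a generator `a` has the exponents of `a`. -/
theorem exponent_eq_of_torusWeight_eq {l : List (Generator k)} {a : Generator k}
    (h : ∀ t, (l.map (torusWeight t)).prod = torusWeight t a) :
    (l.map Generator.exponentZero).sum = a.exponentZero ∧
      ∀ i, (l.map (Generator.exponent i)).sum = a.exponent i := by
  have h2 : ∀ m n : ℤ, (2 : ℝ) ^ m = 2 ^ n → m = n := fun m n =>
    (zpow_right_inj₀ (by norm_num) (by norm_num)).mp
  let two : ℝˣ := Units.mk0 2 two_ne_zero
  constructor
  · have := h (two, 1)
    rw [prod_map_torusWeight, torusWeight_eq] at this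
    exact h2 _ _ (by simpa [two] using this)
  · intro i
    have := h (1, Pi.mulSingle i two)
    rw [prod_map_torusWeight, torusWeight_eq] at this
    have hp : ∀ e : Fin k → ℤ, ∏ j, ((Pi.mulSingle i two : Fin k → ℝˣ) j : ℝ) ^ e j = 2 ^ e i := by
      intro e
      rw [Finset.prod_eq_single i]
      · simp [two]
      · intro j _ hj
        simp [Pi.mulSingle_eq_of_ne hj]
      · simp
    simp only [hp, Units.val_one, one_zpow, one_mul] at this
    exact h2 _ _ this

/-- The part of the degree that the torus does not see: `1` for `w_i`, `0` for `s_I g₄`, `-1` for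
`s_I g₇` (see `deg_eq`). -/
def Generator.defect : Generator k → ℤ
  | .sg4 _ _ => 0
  | .sg7 _ _ => -1
  | .w _ => 1

theorem Generator.deg_eq (a : Generator k) :
    (a.deg : ℤ) = 4 * a.exponentZero + ∑ i, a.exponent i + a.defect := by
  cases a with
  | sg4 I h =>
    simp [Generator.deg, Generator.exponentZero, Generator.exponent, Generator.defect]
    omega
  | sg7 I h =>
    simp [Generator.deg, Generator.exponentZero, Generator.exponent, Generator.defect]
    omega
  | w j => simp [Generator.deg, Generator.exponentZero, Generator.exponent, Generator.defect]

theorem sum_map_deg (l : List (Generator k)) :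
    (((l.map Generator.deg).sum : ℕ) : ℤ) = 4 * (l.map Generator.exponentZero).sum +
      ∑ i, (l.map (Generator.exponent i)).sum + (l.map Generator.defect).sum := by
  induction l with
  | nil => simp
  | cons a l ih =>
    simp only [List.map_cons, List.sum_cons, Nat.cast_add, ih, a.deg_eq, Finset.sum_add_distrib]
    ring

/-- A word with the exponent of `t₀` and the defect of a generator is a single letter. -/
theorem length_eq_one {l : List (Generator k)} {a : Generator k}
    (h0 : (l.map Generator.exponentZero).sum = a.exponentZero)
    (h1 : (l.map Generator.defect).sum = a.defect) : l.length = 1 := by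
  -- `n₄`, `n₇`, `n_w` count the letters of the three kinds.
  obtain ⟨n4, n7, nw, hl, e0, e1⟩ : ∃ n4 n7 nw : ℕ, l.length = n4 + n7 + nw ∧
      (l.map Generator.exponentZero).sum = n4 + 2 * n7 ∧
      (l.map Generator.defect).sum = nw - n7 := by
    clear h0 h1
    induction l with
    | nil => exact ⟨0, 0, 0, by simp⟩
    | cons b l ih =>
      obtain ⟨n4, n7, nw, hl, e0, e1⟩ := ih
      simp only [List.map_cons, List.sum_cons, List.length_cons, e0, e1, hl]
      cases b with
      | sg4 I h =>
        refine ⟨n4 + 1, n7, nw, ?_⟩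
        simp only [Generator.exponentZero, Generator.defect]; omega
      | sg7 I h =>
        refine ⟨n4, n7 + 1, nw, ?_⟩
        simp only [Generator.exponentZero, Generator.defect]; omega
      | w j =>
        refine ⟨n4, n7, nw + 1, ?_⟩
        simp only [Generator.exponentZero, Generator.defect]; omega
  cases a <;> simp only [Generator.exponentZero, Generator.defect] at h0 h1 <;> omega

theorem Generator.eq_of_exponent {a b : Generator k} (h0 : a.exponentZero = b.exponentZero)
    (h : ∀ i, a.exponent i = b.exponent i) : a = b := by
  cases a with
  | sg4 I hI =>
    cases b with
    | sg4 J hJ =>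
      have : I = J := by
        ext i
        have := h i
        simp only [Generator.exponent] at this
        split_ifs at this <;> simp_all
      subst this; rfl
    | sg7 J hJ => simp [Generator.exponentZero] at h0
    | w j => simp [Generator.exponentZero] at h0
  | sg7 I hI =>
    cases b with
    | sg7 J hJ =>
      have : I = J := by
        ext i
        have := h i
        simp only [Generator.exponent] at this
        split_ifs at this <;> simp_all
      subst this; rfl
    | sg4 J hJ => simp [Generator.exponentZero] at h0
    | w j => simp [Generator.exponentZero] at h0
  | w i =>
    cases b with
    | w j =>
      have := h i
      simp only [Generator.exponent] at this
      split_ifs at this <;> simp_all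
    | sg4 J hJ => simp [Generator.exponentZero] at h0
    | sg7 J hJ => simp [Generator.exponentZero] at h0

/-- The pair (degree, character) determines the generators among all words. -/
theorem eq_singleton_of_torusWeight_eq {l : List (Generator k)} {a : Generator k}
    (hd : (l.map Generator.deg).sum = a.deg)
    (h : ∀ t, (l.map (torusWeight t)).prod = torusWeight t a) : l = [a] := by
  obtain ⟨h0, hi⟩ := exponent_eq_of_torusWeight_eq h
  have hdef : (l.map Generator.defect).sum = a.defect := by
    have h1 := sum_map_deg l
    have h2 := a.deg_eq
    rw [hd, h0, Finset.sum_congr rfl fun i _ => hi i] at h1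
    linarith
  obtain ⟨b, rfl⟩ := List.length_eq_one_iff.mp (length_eq_one h0 hdef)
  rw [Generator.eq_of_exponent (a := b) (b := a) (by simpa using h0) (by simpa using hi)]

/-- An automorphism that commutes with the torus preserves each line spanned by a generator. -/
theorem exists_smul_gen {φ : AutModel k} (hφ : ∀ τ ∈ (torusAction k).range, φ * τ = τ * φ)
    (a : Generator k) : ∃ c : ℝ, φ.1 (gen Generator.deg a) = c • gen Generator.deg a := by
  have h1 : φ.1 (gen Generator.deg a) ∈ Submodule.span ℝ
      (word Generator.deg '' {l : List (Generator k) | (l.map Generator.deg).sum = a.deg}) := by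
    have h := (φ.2.1 _ _).mpr (gen_mem_homog Generator.deg a)
    refine Submodule.span_mono ?_ h
    rintro _ ⟨l, hl, rfl⟩
    exact ⟨l, hl, rfl⟩
  have h2 := mem_span_of_forall_eigenvector
    (fun t => (scale (torusWeight t) : Model k →ₐ[ℝ] Model k).toLinearMap)
    (word Generator.deg) (fun t l => (l.map (torusWeight t)).prod)
    (fun t l => scale_word _ l) (fun t => torusWeight t a) h1 (fun t => by
      have h := DFunLike.congr_fun (congrArg Subtype.val (hφ _ ⟨t, rfl⟩)) (gen Generator.deg a)
      change φ.1 (scale (torusWeight t) (gen _ a)) = scale (torusWeight t) (φ.1 (gen _ a)) at h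
      rw [scale_gen, map_smul] at h
      exact h.symm)
  have h3 : word Generator.deg '' {l | l ∈ {l : List (Generator k) |
      (l.map Generator.deg).sum = a.deg} ∧ ∀ t, (l.map (torusWeight t)).prod = torusWeight t a} ⊆
      {gen Generator.deg a} := by
    rintro _ ⟨l, ⟨hl, h⟩, rfl⟩
    rw [eq_singleton_of_torusWeight_eq hl h]
    simp [word]
  obtain ⟨c, hc⟩ := Submodule.mem_span_singleton.mp (Submodule.span_mono h3 h2)
  exact ⟨c, hc.symm⟩

theorem d_sg4_eq_sum (I : Finset (Fin k)) : d k (sg4 I) = ∑ i, w i * s i (sg4 I) := by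
  rw [d_sg4, dg4, sWord_sum, Finset.smul_sum]
  refine Finset.sum_congr rfl fun i _ => ?_
  rw [sWord_w_mul, sWord_s, sWord_sg4, mul_smul_comm, smul_smul, ← mul_pow]
  simp

/-- The differential of `s_I g₇`, up to a combination of products `s_A g₄ · s_B g₄`. -/
theorem exists_d_sg7_eq (I : Finset (Fin k)) :
    ∃ q ∈ quad k I.card, d k (sg7 I) = q + ∑ i, w i * s i (sg7 I) := by
  refine ⟨((-1 : ℝ) ^ I.card) • sWord I (-((1 / 2 : ℝ) • sg4 ∅ ^ 2)), ?_, ?_⟩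
  · refine Submodule.smul_mem _ _ ?_
    rw [← zero_add I.card]
    refine sWord_quad I (neg_mem (Submodule.smul_mem _ _ (Submodule.subset_span ?_)))
    exact ⟨∅, ∅, by simp, pow_two _⟩
  · rw [d_sg7, dg7, sWord_add, smul_add, sWord_sum, Finset.smul_sum]
    congr 1
    refine Finset.sum_congr rfl fun i _ => ?_
    rw [sWord_w_mul, sWord_s, sWord_sg7, mul_smul_comm, smul_smul, ← mul_pow]
    simp

/-- The coefficient of `w_i b`, for a generator `b` different from all `w_j`. -/
noncomputable def coeffWMul [DecidableEq (Generator k)] (i : Fin k) (b : Generator k) :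
    Model k →ₗ[ℝ] ℝ :=
  TrivSqZeroExt.sndHom ℝ ℝ ∘ₗ (tangent (Pi.single (.w i) 1) (Pi.single b 1) (by
    intro a ha
    refine Pi.single_eq_of_ne ?_ _
    rintro rfl
    simp [Generator.deg] at ha
    exact absurd ha (by decide))).toLinearMap

theorem coeffWMul_w_mul_gen [DecidableEq (Generator k)] (i j : Fin k) {b c : Generator k}
    (hb : ∀ l, b ≠ .w l) (hc : ∀ l, c ≠ .w l) :
    coeffWMul i b (w j * gen Generator.deg c) = if j = i ∧ c = b then 1 else 0 := by
  have h1 : (Pi.single (Generator.w i) 1 : Generator k → ℝ) c = 0 := Pi.single_eq_of_ne (hc i) _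
  have h2 : (Pi.single b 1 : Generator k → ℝ) (.w j) = 0 := Pi.single_eq_of_ne (hb j).symm _
  simp only [coeffWMul, w, LinearMap.comp_apply, AlgHom.toLinearMap_apply, map_mul, tangent_gen,
    h1, h2, TrivSqZeroExt.sndHom_apply]
  by_cases hij : j = i <;> by_cases hbc : c = b <;> simp [hij, hbc]

theorem coeffWMul_sg4_mul_sg4 [DecidableEq (Generator k)] (i : Fin k) (b : Generator k)
    (A B : Finset (Fin k)) : coeffWMul i b (sg4 A * sg4 B) = 0 := by
  unfold sg4
  split_ifs
  · simp [coeffWMul, Pi.single_apply]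
  all_goals simp

/-- Compatibility with the differential relates the eigenvalues `a (I ∪ {i})` and `a I` of an
automorphism on `s_i s_I v` and `s_I v`, for `v = g₄` or `g₇`: compare the coefficients `ℓ` of
`w_i · s_i s_I v` in `φ (d (s_I v)) = d (φ (s_I v))`. -/
theorem eigenvalue_insert {φ : AutModel k} {U : Finset (Fin k) → Model k}
    (hU : ∀ i I, s i (U I) = if i ∈ I then 0 else sgn i I • U (insert i I))
    {b : Fin k → ℝ} (hb : ∀ i, φ.1 (w i) = b i • w i)
    {a : Finset (Fin k) → ℝ} (ha : ∀ I, φ.1 (U I) = a I • U I)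
    {I : Finset (Fin k)} {i : Fin k} (hi : i ∉ I) {q : Model k}
    (hd : d k (U I) = q + ∑ j, w j * s j (U I)) {ℓ : Model k →ₗ[ℝ] ℝ}
    (hℓ : ∀ j J, ℓ (w j * U J) = if j = i ∧ J = insert i I then 1 else 0)
    (hq : ℓ q = 0) (hφq : ℓ (φ.1 q) = 0) : b i * a (insert i I) = a I := by
  have hsgn : sgn i I ≠ 0 := pow_ne_zero _ (by norm_num)
  have h1 : ℓ (d k (U I)) = sgn i I := by
    rw [hd, map_add, hq, zero_add, map_sum, Finset.sum_eq_single i]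
    · rw [hU, if_neg hi, mul_smul_comm, map_smul, hℓ]
      simp
    · intro j _ hj
      rw [hU]
      split_ifs
      · simp
      · rw [mul_smul_comm, map_smul, hℓ]
        simp [hj]
    · simp
  have h2 : ℓ (φ.1 (d k (U I))) = sgn i I * (b i * a (insert i I)) := by
    rw [hd, map_add, map_add, hφq, zero_add, map_sum, map_sum, Finset.sum_eq_single i]
    · rw [hU, if_neg hi, mul_smul_comm, map_smul, map_mul, hb, ha, smul_mul_smul_comm, map_smul,
        map_smul, hℓ]
      simp
    · intro j _ hj
      rw [hU]
      split_ifs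
      · simp
      · rw [mul_smul_comm, map_smul, map_mul, hb, ha, smul_mul_smul_comm, map_smul, map_smul, hℓ]
        simp [hj]
    · simp
  rw [φ.2.2, ha, map_smul, map_smul, h1, smul_eq_mul, mul_comm] at h2
  exact (mul_left_cancel₀ hsgn h2).symm

theorem eigenvalue_eq_prod {a : Finset (Fin k) → ℝ} {b : Fin k → ℝ} (hb : ∀ i, b i ≠ 0) {n : ℕ}
    (h : ∀ I i, i ∉ I → (insert i I).card ≤ n → b i * a (insert i I) = a I)
    (I : Finset (Fin k)) (hI : I.card ≤ n) : a I = a ∅ * ∏ i ∈ I, (b i)⁻¹ := by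
  induction I using Finset.induction_on with
  | empty => simp
  | insert i I hi ih =>
    have h1 := h I i hi hI
    rw [ih ((Finset.card_le_card (Finset.subset_insert i I)).trans hI)] at h1
    rw [Finset.prod_insert hi, mul_left_comm, ← h1, inv_mul_cancel_left₀ (hb i)]

/-- The torus is its own centralizer. -/
theorem mem_range_torusAction_of_commute {φ : AutModel k}
    (hφ : ∀ τ ∈ (torusAction k).range, φ * τ = τ * φ) : φ ∈ (torusAction k).range := by
  classical
  choose c hc using exists_smul_gen hφ
  have hc0 : ∀ a, c a ≠ 0 := by
    intro a h
    have := hc a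
    rw [h, zero_smul] at this
    exact gen_ne_zero a ((map_eq_zero_iff φ.1 φ.1.injective).mp this)
  let a4 : Finset (Fin k) → ℝ := fun I => if h : I.card ≤ 3 then c (.sg4 I h) else 0
  let a7 : Finset (Fin k) → ℝ := fun I => if h : I.card ≤ 6 then c (.sg7 I h) else 0
  let b : Fin k → ℝ := fun i => c (.w i)
  have h4 : ∀ I, φ.1 (sg4 I) = a4 I • sg4 I := by
    intro I
    by_cases h : I.card ≤ 3
    · simp only [a4, sg4, dif_pos h, hc]
    · simp [sg4, h]
  have h7 : ∀ I, φ.1 (sg7 I) = a7 I • sg7 I := by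
    intro I
    by_cases h : I.card ≤ 6
    · simp only [a7, sg7, dif_pos h, hc]
    · simp [sg7, h]
  have hb : ∀ i, φ.1 (w i) = b i • w i := fun i => hc _
  have hb0 : ∀ i, b i ≠ 0 := fun i => hc0 _
  have p4 := eigenvalue_eq_prod (a := a4) hb0 (n := 3) fun I i hi hI => by
    refine eigenvalue_insert s_sg4 hb h4 hi (q := 0) (by rw [zero_add, d_sg4_eq_sum])
      (ℓ := coeffWMul i (.sg4 (insert i I) hI)) (fun j J => ?_) (map_zero _) (by simp)
    by_cases hJ : J.card ≤ 3
    · rw [sg4_of_card_le hJ, coeffWMul_w_mul_gen _ _ (by simp) (by simp)]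
      simp
    · rw [sg4, dif_neg hJ, mul_zero, map_zero, if_neg]
      rintro ⟨-, rfl⟩
      exact hJ hI
  have p7 := eigenvalue_eq_prod (a := a7) hb0 (n := 6) fun I i hi hI => by
    obtain ⟨q, hq, hd⟩ := exists_d_sg7_eq I
    have hq0 : ∀ x ∈ quad k I.card, coeffWMul i (.sg7 (insert i I) hI) x = 0 := by
      intro x hx
      induction hx using Submodule.span_induction with
      | mem x h =>
        obtain ⟨A, B, -, rfl⟩ := h
        exact coeffWMul_sg4_mul_sg4 _ _ A B
      | zero => simp
      | add x y _ _ hx hy => rw [map_add, hx, hy, add_zero]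
      | smul r x _ hx => rw [map_smul, hx, smul_zero]
    have hφq : φ.1 q ∈ quad k I.card := by
      clear hd
      induction hq using Submodule.span_induction with
      | mem x h =>
        obtain ⟨A, B, hAB, rfl⟩ := h
        rw [map_mul, h4, h4, smul_mul_smul_comm]
        exact Submodule.smul_mem _ _ (Submodule.subset_span ⟨A, B, hAB, rfl⟩)
      | zero => simp
      | add x y _ _ hx hy => rw [map_add]; exact add_mem hx hy
      | smul r x _ hx => rw [map_smul]; exact Submodule.smul_mem _ _ hx
    refine eigenvalue_insert s_sg7 hb h7 hi hd
      (ℓ := coeffWMul i (.sg7 (insert i I) hI)) (fun j J => ?_) (hq0 q hq) (hq0 _ hφq)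
    by_cases hJ : J.card ≤ 6
    · rw [sg7_of_card_le hJ, coeffWMul_w_mul_gen _ _ (by simp) (by simp)]
      simp
    · rw [sg7, dif_neg hJ, mul_zero, map_zero, if_neg]
      rintro ⟨-, rfl⟩
      exact hJ hI
  -- The coefficient of `g₄²` in `φ (d g₇) = d (φ g₇)`, read off at the point `g₄ = 1`.
  have hsq : a7 ∅ = a4 ∅ ^ 2 := by
    let E : Model k →ₐ[ℝ] ℝ := (TrivSqZeroExt.fstHom ℝ ℝ ℝ).comp
      (tangent (Pi.single (.sg4 ∅ (by simp)) 1) 0 (by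
        intro a ha
        refine Pi.single_eq_of_ne ?_ _
        rintro rfl
        simp [Generator.deg] at ha
        exact absurd ha (by decide)))
    have Ew : ∀ i, E (w i) = 0 := fun i => by simp [E, w]
    have Eg : E (sg4 ∅) = 1 := by
      rw [sg4_of_card_le (by simp)]
      simp [E]
    have h := congrArg E (φ.2.2 (sg7 ∅))
    rw [h7, map_smul, map_smul, d_g7] at h
    simp only [map_add, map_neg, map_smul, map_pow, map_sum, map_mul, hb, h4, Ew, Eg,
      smul_eq_mul, mul_one, mul_zero, zero_mul, Finset.sum_const_zero, add_zero, one_pow] at h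
    linarith
  refine ⟨(Units.mk0 (a4 ∅) (by simpa [a4] using hc0 _), fun i => Units.mk0 (b i) (hb0 i)),
    AutModel.ext_gen fun a => ?_⟩
  rw [torusAction_apply]
  cases a with
  | sg4 I hI =>
    rw [← sg4_of_card_le, scale_sg4, h4, p4 I hI]
    rfl
  | sg7 I hI =>
    rw [← sg7_of_card_le, scale_sg7, h7, p7 I hI, hsq]
    rfl
  | w i => exact (scale_w _ i).trans (hb i).symm

/-- A split torus is commutative, so one that contains `T` centralizes it. -/
theorem isMaximalSplitTorus_range_torusAction (k : ℕ) :
    IsMaximalSplitTorus (AutModel.regular k) (torusAction k).range := by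
  refine ⟨isSplitTorus_range_torusAction k, fun T' hT' hle => le_antisymm ?_ hle⟩
  obtain ⟨r, θ, -, -, rfl⟩ := hT'
  rintro _ ⟨t, rfl⟩
  refine mem_range_torusAction_of_commute fun τ hτ => ?_
  obtain ⟨t', rfl⟩ := hle hτ
  rw [← map_mul, ← map_mul, mul_comm]

end Centralizer

end Toroidification

theorem theorem4p1 (k : ℕ) :
    Toroidification.IsRealAlgebraicGroup (Toroidification.AutModel.regular k) ∧
    ∃ θ : ℝˣ × (Fin k → ℝˣ) →* Toroidification.AutModel k,
      Toroidification.ActsByWeights k θ ∧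
      (∀ θ' : ℝˣ × (Fin k → ℝˣ) →* Toroidification.AutModel k,
        Toroidification.ActsByWeights k θ' → θ' = θ) ∧
      Function.Injective θ ∧
      Toroidification.IsClosedEmbedding (Toroidification.gmTorusRegular k)
        (Toroidification.AutModel.regular k) θ ∧
      Toroidification.IsMaximalSplitTorus (Toroidification.AutModel.regular k) θ.range ∧
      ∀ φ : Toroidification.AutModel k, (∀ τ ∈ θ.range, φ * τ = τ * φ) → φ ∈ θ.range :=
  ⟨Toroidification.isRealAlgebraicGroup_autModel k, Toroidification.torusAction k,
    Toroidification.actsByWeights_torusAction k, fun _ h => Toroidification.eq_torusAction h,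
    Toroidification.torusAction_injective k, Toroidification.isClosedEmbedding_torusAction k,
    Toroidification.isMaximalSplitTorus_range_torusAction k,
    fun _ h => Toroidification.mem_range_torusAction_of_commute h⟩
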